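/- **Lemma (Existence of the Prior Transition Map).** Let $P_1,P_2$ be Borel probability measures on $\mathbb R^d$ with finite second moments, both absolutely continuous with respect to Lebesgue measure. For Borel $g:\mathbb R^d\to\mathbb R^d$ with $g_\sharp P_1=P_2$ consider the cost $\int\|u-g(u)\|^2\,\mathrm dP_1(u)$, and call $g$ *optimal* if it attains the infimum of this cost over all such maps. Call $g$ a *convex gradient* if there are an open convex set $C\subseteq\mathbb R^d$ with $P_1(C)=1$ and a convex function $\phi:C\to\mathbb R$ such that, for $P_1$-a.e. $u$, $\phi$ is differentiable at $u$ with $g(u)=\nabla\phi(u)$. (a) There is an optimal map $g$ with $g_\sharp P_1=P_2$. It has finite cost, and * it is a convex gradient; * it is monotone $P_1$-a.e.: there is a Borel set $S$ with $P_1(S)=1$ and $\langle g(u)-g(v),u-v\rangle\ge 0$ for all $u,v\in S$; * it is a.e. bijective: it restricts to a bijection from a Borel set of full $P_1$-measure onto a Borel set of full $P_2$-measure; * it is unique $P_1$-a.e.: every optimal map, and every convex gradient that pushes $P_1$ forward to $P_2$, is $P_1$-a.e. equal to $g$. (b) Let $P$ be any probability measure on $\mathbb R^d$ that is absolutely continuous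 with respect to Lebesgue measure. Let $R=(R_1,\dots,R_d)$ be its Rosenblatt map, defined recursively by $$R_k(u)=\inf\{t\in\mathbb R: u_k\le F_k(t\mid R_1(u),\dots,R_{k-1}(u))\},$$ (with value $0$ by convention where this infimum is not a real number), where $F_k(\cdot\mid x_1,\dots,x_{k-1})$ is the conditional distribution function under $P$ of the $k$-th coordinate given the preceding ones. Then $R$ is Borel measurable and triangular ($R_k(u)$ depends only on $u_1,\dots,u_k$), $R_\sharp\,\mathcal U([0,1]^d)=P$, and $R$ restricts to a bijection from a Borel set of full $\mathcal U([0,1]^d)$-measure onto a Borel set of full $P$-measure. Consequently the prior may be taken to be uniform: for every $m\ge 0$ and every $T:\mathbb R^d\times\mathbb R^m\to\mathbb R^d$, Borel in its first argument, the map $\widetilde T(u;\mathrm{pa})=T(R(u);\mathrm{pa})$ with prior $\mathcal U([0,1]^d)$ is counterfactually equivalent to $T$ with prior $P$. That is, there is a Borel isomorphism $h$ of $\mathbb R^d$ with $h_\sharp\,\mathcal U([0,1]^d)=P$ such that for $P$-a.e. $u$ and all $\mathrm{pa}$, $T(u;\mathrm{pa})=\widetilde T(h^{-1}(u);\mathrm{pa})$.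 Moreover $\widetilde T(\cdot;\mathrm{pa})_\sharp\,\mathcal U([0,1]^d)=T(\cdot;\mathrm{pa})_\sharp P$ for all $\mathrm{pa}$. -/

import Mathlib

open MeasureTheory ProbabilityTheory

noncomputable section

namespace PriorTransport

/-- Euclidean space of dimension `d`. -/
abbrev E (d : ℕ) : Type := EuclideanSpace ℝ (Fin d)

/-- The quadratic transport cost of the map `g` from the measure `P`. -/
def quadCost {d : ℕ} (P : Measure (E d)) (g : E d → E d) : ENNReal :=
  ∫⁻ u, ENNReal.ofReal (‖u - g u‖ ^ 2) ∂P

/-- `g` pushes `P` forward to `Q` and attains the infimum of the quadratic cost among all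
Borel maps that do so (the Monge problem). -/
def IsOptimalMap {d : ℕ} (P Q : Measure (E d)) (g : E d → E d) : Prop :=
  MeasurePreserving g P Q ∧
    quadCost P g = ⨅ (T : E d → E d) (_ : MeasurePreserving T P Q), quadCost P T

/-- `g` is `P`-a.e. the gradient of a convex function. The convex function may take the value
`+∞`; it is represented by its finite values on an open convex set of full `P`-measure. -/
def IsConvexGradient {d : ℕ} (P : Measure (E d)) (g : E d → E d) : Prop :=
  ∃ (C : Set (E d)) (φ : E d → ℝ), IsOpen C ∧ ConvexOn ℝ C φ ∧ (∀ᵐ u ∂P, u ∈ C) ∧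
    ∀ᵐ u ∂P, HasGradientAt φ (g u) u

/-- `g` is a monotone operator on a Borel set of full `P`-measure. -/
def IsMonotoneAE {d : ℕ} (P : Measure (E d)) (g : E d → E d) : Prop :=
  ∃ S : Set (E d), MeasurableSet S ∧ (∀ᵐ u ∂P, u ∈ S) ∧
    ∀ u ∈ S, ∀ v ∈ S, 0 ≤ inner ℝ (g u - g v) (u - v)

/-- `g` is a bijection from a Borel set of full `P`-measure onto a Borel set of full
`Q`-measure. -/
def IsBijectiveAE {d : ℕ} (P Q : Measure (E d)) (g : E d → E d) : Prop :=
  ∃ S T : Set (E d), MeasurableSet S ∧ MeasurableSet T ∧ (∀ᵐ u ∂P, u ∈ S) ∧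
    (∀ᵐ x ∂Q, x ∈ T) ∧ Set.BijOn g S T

/-- The uniform probability measure on the cube `[0,1]^d`. -/
def unifCube (d : ℕ) : Measure (E d) :=
  volume.restrict {u : E d | ∀ i, u i ∈ Set.Icc (0 : ℝ) 1}

/-- The first `k` coordinates of a vector. -/
def initialCoords {d : ℕ} (k : Fin d) (x : E d) : Fin (k : ℕ) → ℝ :=
  fun j => x ⟨j, j.isLt.trans k.isLt⟩

/-- The conditional cumulative distribution function, under `P`, of the `k`-th coordinate given
that the coordinates before it are equal to `a`, evaluated at `t`. -/
def condCoordCDF {d : ℕ} (P : Measure (E d)) [IsFiniteMeasure P] (k : Fin d)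
    (a : Fin (k : ℕ) → ℝ) (t : ℝ) : ℝ :=
  cdf (condDistrib (fun x : E d => x k) (initialCoords k) P a) t

/-- The (generalized) inverse of a cumulative distribution function at level `p ∈ (0,1)`. -/
def quantile (F : ℝ → ℝ) (p : ℝ) : ℝ := sInf {t : ℝ | p ≤ F t}

/-- The `k`-th coordinate of the triangular map of `P`, by recursion on the coordinates:
`T_k(u_1,…,u_k)` is the conditional quantile at level `u_k` of the `k`-th coordinate given that
the coordinates before it are `T_1(u_1),…,T_{k-1}(u_1,…,u_{k-1})`. -/
def rosenblattCoord {d : ℕ} (P : Measure (E d)) [IsFiniteMeasure P] (u : E d) (k : Fin d) : ℝ :=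
  quantile (condCoordCDF P k
    (fun j : Fin (k : ℕ) => rosenblattCoord P u ⟨j, j.isLt.trans k.isLt⟩)) (u k)
termination_by (k : ℕ)
decreasing_by exact j.isLt

/-- The Rosenblatt map of `P`, from the unit cube to `ℝ^d`. -/
def rosenblatt {d : ℕ} (P : Measure (E d)) [IsFiniteMeasure P] (u : E d) : E d :=
  WithLp.toLp 2 (fun k => rosenblattCoord P u k)

/-- A map is triangular if its `k`-th coordinate depends only on the coordinates up to `k`. -/
def IsTriangular {d : ℕ} (T : E d → E d) : Prop :=
  ∀ (k : Fin d) (u v : E d), (∀ j ≤ k, u j = v j) → T u k = T v k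

/-- Counterfactual equivalence of two mechanisms `T₁`, `T₂` (functions of the noise and of the
parents) with priors `P₁`, `P₂`: a Borel bijection `g` carries `P₂` to `P₁` and intertwines them. -/
def TransportEquiv {d k : ℕ} (T₁ : E d → E k → E d) (P₁ : Measure (E d))
    (T₂ : E d → E k → E d) (P₂ : Measure (E d)) : Prop :=
  ∃ g : E d ≃ᵐ E d, P₂.map g = P₁ ∧ ∀ᵐ u ∂P₁, ∀ pa, T₁ u pa = T₂ (g.symm u) pa

end PriorTransport

end

namespace PriorTransport

open Filter Topology Set
open scoped ENNReal NNReal BoundedContinuousFunction RealInnerProductSpace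

/-! ### Quantile functions -/

/-! For (a), the marginals fix the second moments, so minimizing the quadratic cost of a coupling
means maximizing `∫ ⟪x, y⟫`. Couplings form a weakly compact set, which gives an optimal one.
Rerouting mass cannot lower its cost, so its support is cyclically monotone, and Rockafellar's
theorem places it in the subdifferential of a convex function. Absolute continuity of the first
marginal makes that function differentiable where it matters, so the coupling lies on the graph of a
gradient. The swapped coupling is optimal too, which yields an a.e. inverse. The average of two
optimal graph couplings is again optimal, hence carried by one graph, which forces uniqueness.
Convex gradients are optimal by Fenchel–Young duality.

For (b), a quantile function carries the uniform law to the law it inverts. Applied to conditional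
laws with independent uniform levels, it rebuilds `P` one coordinate at a time. Absolute continuity
removes atoms from the conditional laws, so each level is recovered as a conditional distribution
function value. The resulting a.e. bijection becomes a Borel isomorphism after uncountable null sets
are set aside, since uncountable standard Borel spaces are isomorphic. -/

theorem bddBelow_setOf_le_cdf (μ : Measure ℝ) {p : ℝ} (hp : 0 < p) :
    BddBelow {t : ℝ | p ≤ cdf μ t} := by
  obtain ⟨b, hb⟩ := eventually_atBot.1 ((tendsto_cdf_atBot μ).eventually_lt_const hp)
  refine ⟨b, fun t ht => ?_⟩
  by_contra! h
  exact absurd (hb t h.le) (not_lt.2 ht)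

theorem nonempty_setOf_le_cdf (μ : Measure ℝ) {p : ℝ} (hp : p < 1) :
    {t : ℝ | p ≤ cdf μ t}.Nonempty := by
  obtain ⟨t, ht⟩ := ((tendsto_cdf_atTop μ).eventually_const_lt hp).exists
  exact ⟨t, ht.le⟩

/-- Right-continuity of the distribution function makes the infimum attained. This Galois connection
underlies all later facts about quantiles. -/
theorem quantile_cdf_le_iff (μ : Measure ℝ) {p : ℝ} (hp : 0 < p)
    (hne : {t : ℝ | p ≤ cdf μ t}.Nonempty) (t : ℝ) :
    quantile (cdf μ) p ≤ t ↔ p ≤ cdf μ t := by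
  have hb := bddBelow_setOf_le_cdf μ hp
  constructor
  · intro h
    refine le_trans ?_ (monotone_cdf μ h)
    rw [← (cdf μ).iInf_Ioi_eq (quantile (cdf μ) p)]
    have : Nonempty (Ioi (quantile (cdf μ) p)) := ⟨⟨quantile (cdf μ) p + 1, mem_Ioi.2 (lt_add_one _)⟩⟩
    refine le_ciInf fun r => ?_
    obtain ⟨s, hs, hsr⟩ := exists_lt_of_csInf_lt hne r.2
    exact le_trans hs (monotone_cdf μ hsr.le)
  · intro h
    exact csInf_le hb h

/-- Left of the quantile the distribution function stays below `p`, and without an atom it cannot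
jump there. -/
theorem cdf_quantile (μ : Measure ℝ) [IsProbabilityMeasure μ] [NullSingletonClass μ] {p : ℝ}
    (hp : p ∈ Ioo (0 : ℝ) 1) : cdf μ (quantile (cdf μ) p) = p := by
  have hne := nonempty_setOf_le_cdf μ hp.2
  set q := quantile (cdf μ) p with hq
  refine le_antisymm ?_ ((quantile_cdf_le_iff μ hp.1 hne q).1 le_rfl)
  have h1 : (cdf μ).measure {q} = 0 := by rw [measure_cdf]; exact measure_singleton q
  rw [StieltjesFunction.measure_singleton, ENNReal.ofReal_eq_zero] at h1
  have h2 : Function.leftLim (cdf μ) q ≤ p := by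
    refine le_of_tendsto ((monotone_cdf μ).tendsto_leftLim q) ?_
    filter_upwards [self_mem_nhdsWithin] with t ht
    by_contra! h
    exact absurd ((quantile_cdf_le_iff μ hp.1 hne t).2 h.le) (not_le.2 ht)
  linarith

theorem measurable_quantile_kernel {α : Type*} [MeasurableSpace α] (κ : Kernel α ℝ)
    [IsMarkovKernel κ] :
    Measurable fun x : α × ℝ => quantile (cdf (κ x.1)) x.2 := by
  have hm : ∀ t : ℝ, Measurable fun x : α × ℝ => cdf (κ x.1) t := by
    intro t
    simp_rw [cdf_eq_real, measureReal_def]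
    exact ((κ.measurable_coe measurableSet_Iic).comp measurable_fst).ennreal_toReal
  have hle : ∀ t : ℝ, MeasurableSet {x : α × ℝ | x.2 ≤ cdf (κ x.1) t} := fun t =>
    measurableSet_le measurable_snd (hm t)
  have hpos : MeasurableSet {x : α × ℝ | 0 < x.2} :=
    measurableSet_lt measurable_const measurable_snd
  have hne : MeasurableSet {x : α × ℝ | ∃ n : ℕ, x.2 ≤ cdf (κ x.1) n} := by
    have : {x : α × ℝ | ∃ n : ℕ, x.2 ≤ cdf (κ x.1) n} =
        ⋃ n : ℕ, {x : α × ℝ | x.2 ≤ cdf (κ x.1) n} := by ext; simp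
    rw [this]
    exact MeasurableSet.iUnion fun n => hle n
  have hne_iff : ∀ x : α × ℝ, (∃ n : ℕ, x.2 ≤ cdf (κ x.1) n) ↔
      {t : ℝ | x.2 ≤ cdf (κ x.1) t}.Nonempty := by
    intro x
    constructor
    · rintro ⟨n, hn⟩
      exact ⟨n, hn⟩
    · rintro ⟨t, ht⟩
      obtain ⟨n, hn⟩ := exists_nat_ge t
      exact ⟨n, le_trans ht (monotone_cdf _ hn)⟩
  refine measurable_of_Iic fun t => ?_
  have : (fun x : α × ℝ => quantile (cdf (κ x.1)) x.2) ⁻¹' Iic t =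
      ({x | 0 < x.2} ∩ {x | ∃ n : ℕ, x.2 ≤ cdf (κ x.1) n}) ∩ {x | x.2 ≤ cdf (κ x.1) t} ∪
      ({x | 0 < x.2} ∩ {x | ∃ n : ℕ, x.2 ≤ cdf (κ x.1) n})ᶜ ∩ {_x | 0 ≤ t} := by
    ext x
    by_cases hx : 0 < x.2 ∧ ∃ n : ℕ, x.2 ≤ cdf (κ x.1) n
    · have := quantile_cdf_le_iff (κ x.1) hx.1 ((hne_iff x).1 hx.2) t
      simp only [mem_preimage, mem_Iic, mem_union, mem_inter_iff, mem_ofPred_eq, mem_compl_iff,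
        hx.1, hx.2, this]
      simp
    -- The defining set is all of `ℝ` for a nonpositive level and empty for an unattained one;
    -- `sInf` is `0` in both cases.
    · have h0 : quantile (cdf (κ x.1)) x.2 = 0 := by
        rw [not_and_or, not_lt] at hx
        rcases hx with hx | hx
        · have : {t : ℝ | x.2 ≤ cdf (κ x.1) t} = univ :=
            eq_univ_of_forall fun t => le_trans hx (cdf_nonneg _ t)
          rw [quantile, this, Real.sInf_univ]
        · rw [hne_iff, not_nonempty_iff_eq_empty] at hx
          rw [quantile, hx, Real.sInf_empty]
      simp only [mem_preimage, mem_Iic, h0, mem_union, mem_inter_iff, mem_ofPred_eq, mem_compl_iff,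
        hx]
      simp
  rw [this]
  exact ((hpos.inter hne).inter (hle t)).union ((hpos.inter hne).compl.inter (.const _))

theorem measurable_quantile_cdf (μ : Measure ℝ) [IsProbabilityMeasure μ] :
    Measurable (quantile (cdf μ)) :=
  (measurable_quantile_kernel (Kernel.const Unit μ)).comp
    (measurable_const.prodMk measurable_id : Measurable fun p : ℝ => ((), p))

instance isProbabilityMeasure_restrict_Icc :
    IsProbabilityMeasure ((volume : Measure ℝ).restrict (Icc 0 1)) :=
  ⟨by simp⟩

theorem ae_mem_Ioo_restrict_Icc : ∀ᵐ p ∂(volume : Measure ℝ).restrict (Icc 0 1),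
    p ∈ Ioo (0 : ℝ) 1 := by
  rw [← restrict_Ioo_eq_restrict_Icc]
  exact ae_restrict_mem measurableSet_Ioo

/-- Inverse transform sampling: by the Galois connection, the quantile is at most `t` exactly for
levels up to `cdf μ t`, apart from the null endpoints. -/
theorem map_quantile_cdf (μ : Measure ℝ) [IsProbabilityMeasure μ] :
    ((volume : Measure ℝ).restrict (Icc 0 1)).map (quantile (cdf μ)) = μ := by
  have hm := measurable_quantile_cdf μ
  have : IsProbabilityMeasure (((volume : Measure ℝ).restrict (Icc 0 1)).map
    (quantile (cdf μ))) := Measure.isProbabilityMeasure_map hm.aemeasurable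
  refine Measure.ext_of_Iic _ _ fun t => ?_
  rw [Measure.map_apply hm measurableSet_Iic]
  have h1 : (quantile (cdf μ) ⁻¹' Iic t : Set ℝ) =ᵐ[(volume : Measure ℝ).restrict (Icc 0 1)]
      (Iic (cdf μ t) : Set ℝ) := by
    filter_upwards [ae_mem_Ioo_restrict_Icc] with p hp
    exact propext (quantile_cdf_le_iff μ hp.1 (nonempty_setOf_le_cdf μ hp.2) t)
  rw [measure_congr h1, Measure.restrict_apply measurableSet_Iic]
  have h2 : Iic (cdf μ t) ∩ Icc 0 1 = Icc 0 (cdf μ t) := by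
    ext p
    have := cdf_le_one μ t
    simp only [mem_inter_iff, mem_Iic, mem_Icc]
    constructor
    · rintro ⟨h, h', -⟩; exact ⟨h', h⟩
    · rintro ⟨h, h'⟩; exact ⟨h', h, h'.trans this⟩
  rw [h2, Real.volume_Icc, sub_zero, ofReal_cdf]

theorem map_prod_quantile {α : Type*} [MeasurableSpace α] (μ : Measure α) [SFinite μ]
    (κ : Kernel α ℝ) [IsMarkovKernel κ] :
    (μ.prod ((volume : Measure ℝ).restrict (Icc 0 1))).map
      (fun x => (x.1, quantile (cdf (κ x.1)) x.2)) = μ.compProd κ := by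
  have hm : Measurable fun x : α × ℝ => (x.1, quantile (cdf (κ x.1)) x.2) :=
    measurable_fst.prodMk (measurable_quantile_kernel κ)
  ext s hs
  rw [Measure.map_apply hm hs, Measure.prod_apply (hm hs), Measure.compProd_apply hs]
  refine lintegral_congr fun a => ?_
  have hs' : MeasurableSet (Prod.mk a ⁻¹' s) := measurable_prodMk_left hs
  conv_rhs => rw [← map_quantile_cdf (κ a)]
  rw [Measure.map_apply (measurable_quantile_cdf (κ a)) hs']
  rfl

/-- A disintegration of a measure that is absolutely continuous with respect to a product with
Lebesgue measure has no atoms. -/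
theorem ae_nullSingletonClass_of_compProd {α : Type*} [MeasurableSpace α]
    {μ ν : Measure α} [SFinite μ] [SFinite ν] (κ : Kernel α ℝ) [IsMarkovKernel κ]
    (h : μ.compProd κ ≪ ν.prod volume) : ∀ᵐ a ∂μ, NullSingletonClass (κ a) := by
  have hmeas : Measurable fun x : α × ℝ => κ x.1 {x.2} := by
    have hd : MeasurableSet {y : (α × ℝ) × ℝ | y.2 = y.1.2} :=
      measurableSet_eq_fun measurable_snd (measurable_snd.comp measurable_fst)
    have := Kernel.measurable_kernel_prodMk_left (κ := Kernel.prodMkRight ℝ κ) hd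
    simpa using! this
  -- `D` collects the atoms. A finite measure has countably many, so `D` has Lebesgue-null fibres
  -- and is null for the product, hence for the disintegrated measure.
  set D : Set (α × ℝ) := {x | 0 < κ x.1 {x.2}} with hD
  have hDm : MeasurableSet D := measurableSet_lt measurable_const hmeas
  have hcount : ∀ a, {t : ℝ | 0 < κ a {t}}.Countable := fun a =>
    Measure.countable_meas_level_set_pos (μ := κ a) (g := id) measurable_id
  have h0 : (ν.prod volume) D = 0 := by
    rw [Measure.prod_apply hDm]
    simp only [lintegral_eq_zero_iff (measurable_measure_prodMk_left hDm)]
    exact Eventually.of_forall fun a => (hcount a).measure_zero _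
  have h1 := h h0
  rw [Measure.compProd_apply hDm,
    lintegral_eq_zero_iff (Kernel.measurable_kernel_prodMk_left hDm)] at h1
  filter_upwards [h1] with a ha
  refine ⟨fun t => ?_⟩
  by_contra hne
  have ht : {t} ⊆ Prod.mk a ⁻¹' D := by
    rintro _ rfl
    exact pos_iff_ne_zero.2 hne
  exact hne (measure_mono_null ht ha)

/-! ### Bijections up to null sets -/

/-- By Lusin–Souslin, the injective Borel image of a Borel set is Borel; its full measure follows
from measure preservation. -/
theorem IsBijectiveAE.of_injOn {d : ℕ} {P Q : Measure (E d)} {g : E d → E d} {S : Set (E d)}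
    (hg : MeasurePreserving g P Q) (hS : MeasurableSet S) (hPS : ∀ᵐ u ∂P, u ∈ S)
    (hinj : InjOn g S) : IsBijectiveAE P Q g := by
  have hT := hS.image_of_measurable_injOn hg.measurable hinj
  refine ⟨S, g '' S, hS, hT, hPS, ?_, hinj.bijOn_image⟩
  rw [← hg.map_eq]
  refine (ae_map_iff hg.measurable.aemeasurable hT).2 ?_
  exact hPS.mono fun u hu => mem_image_of_mem g hu

/-- Liouville numbers are comeagre. Were they countable, their complement would be comeagre too,
contradicting Baire. -/
theorem not_countable_setOf_liouville : ¬ {x : ℝ | Liouville x}.Countable := by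
  intro h
  have h1 : {x : ℝ | Liouville x}ᶜ ∈ residual ℝ := by
    have : Countable {x : ℝ | Liouville x} := h.to_subtype
    have h2 : {x : ℝ | Liouville x}ᶜ = ⋂ y : {x : ℝ | Liouville x}, {(y : ℝ)}ᶜ := by
      ext x
      simp only [mem_compl_iff, mem_iInter, mem_singleton_iff]
      exact ⟨fun hx y hxy => hx (hxy ▸ y.2), fun hx hl => hx ⟨x, hl⟩ rfl⟩
    rw [h2]
    exact countable_iInter_mem.2 fun y =>
      residual_of_dense_open isOpen_compl_singleton (dense_compl_singleton (y : ℝ))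
  obtain ⟨x, hx, hx'⟩ := (dense_of_mem_residual
    (inter_mem eventually_residual_liouville h1)).nonempty
  exact hx' hx

theorem exists_null_not_countable {d : ℕ} (hd : 0 < d) {P : Measure (E d)} (hP : P ≪ volume) :
    ∃ M : Set (E d), MeasurableSet M ∧ P M = 0 ∧ ¬ M.Countable := by
  set e : E d → ℝ := fun x => x ⟨0, hd⟩ with he
  have hq : Measure.QuasiMeasurePreserving e volume volume :=
    (Measure.quasiMeasurePreserving_eval (fun _ : Fin d => (volume : Measure ℝ)) ⟨0, hd⟩).comp
      (PiLp.volume_preserving_ofLp (Fin d)).quasiMeasurePreserving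
  have h0 : volume (e ⁻¹' {x : ℝ | Liouville x}) = 0 :=
    hq.preimage_null volume_setOfPred_liouville
  refine ⟨toMeasurable volume (e ⁻¹' {x : ℝ | Liouville x}), measurableSet_toMeasurable _ _,
    hP (by rw [measure_toMeasurable, h0]), fun hc => ?_⟩
  have hc' := (hc.mono (subset_toMeasurable _ _)).image e
  rw [image_preimage_eq _ fun t => ⟨WithLp.toLp 2 fun _ => t, rfl⟩] at hc'
  exact not_countable_setOf_liouville hc'

/-- A Borel bijection between Borel sets whose complements are uncountable extends to a Borel
isomorphism of the whole space. -/
theorem exists_measurableEquiv_eqOn {X : Type*} [MeasurableSpace X] [StandardBorelSpace X]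
    {f : X → X} (hf : Measurable f) {S T : Set X} (hS : MeasurableSet S) (hT : MeasurableSet T)
    (hST : BijOn f S T) (hSc : ¬ Sᶜ.Countable) (hTc : ¬ Tᶜ.Countable) :
    ∃ g : X ≃ᵐ X, EqOn g f S := by
  classical
  have : StandardBorelSpace S := hS.standardBorel
  have : StandardBorelSpace T := hT.standardBorel
  have : StandardBorelSpace (Sᶜ : Set X) := hS.compl.standardBorel
  have : StandardBorelSpace (Tᶜ : Set X) := hT.compl.standardBorel
  let f' : S → T := hST.mapsTo.restrict f S T
  have hf' : Measurable f' := (hf.comp measurable_subtype_coe).subtype_mk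
  have hbij : Function.Bijective f' := hST.bijective
  let e₁ : S ≃ᵐ T :=
    { toEquiv := Equiv.ofBijective f' hbij
      measurable_toFun := hf'
      measurable_invFun := by
        intro s hs
        have := hs.image_of_measurable_injOn hf' hbij.injective.injOn
        exact (Equiv.image_eq_preimage_symm (Equiv.ofBijective f' hbij) s) ▸ this }
  -- Any two uncountable standard Borel spaces are isomorphic, so the complements can be matched
  -- arbitrarily.
  let e₂ : (Sᶜ : Set X) ≃ᵐ (Tᶜ : Set X) :=
    PolishSpace.measurableEquivOfNotCountable (fun h => hSc (countable_coe_iff.1 h))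
      (fun h => hTc (countable_coe_iff.1 h))
  refine ⟨(MeasurableEquiv.sumCompl hS).symm.trans
    ((MeasurableEquiv.sumCongr e₁ e₂).trans (MeasurableEquiv.sumCompl hT)), fun x hx => ?_⟩
  have : (MeasurableEquiv.sumCompl hS).symm x = Sum.inl ⟨x, hx⟩ :=
    Equiv.sumCompl_symm_apply_of_pos (p := (· ∈ S)) hx
  simp only [MeasurableEquiv.trans_apply, this]
  rfl

/-- Discarding an uncountable null set on each side costs nothing almost everywhere and leaves
uncountable complements to match up. -/
theorem exists_measurableEquiv_ae_eq {d : ℕ} (hd : 0 < d) {P Q : Measure (E d)}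
    (hP : P ≪ volume) (hQ : Q ≪ volume) {f : E d → E d} (hf : MeasurePreserving f P Q)
    (hb : IsBijectiveAE P Q f) : ∃ g : E d ≃ᵐ E d, g =ᵐ[P] f := by
  obtain ⟨S, T, hS, hT, hPS, hQT, hST⟩ := hb
  obtain ⟨M, hM, hPM, hMc⟩ := exists_null_not_countable hd hP
  obtain ⟨N, hN, hQN, hNc⟩ := exists_null_not_countable hd hQ
  set S' := S ∩ (Mᶜ ∩ f ⁻¹' Nᶜ) with hS'def
  have hS' : MeasurableSet S' := hS.inter (hM.compl.inter (hf.measurable hN.compl))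
  have hinj : InjOn f S' := hST.injOn.mono inter_subset_left
  have hT' : MeasurableSet (f '' S') := hS'.image_of_measurable_injOn hf.measurable hinj
  obtain ⟨g, hg⟩ := exists_measurableEquiv_eqOn hf.measurable hS' hT' hinj.bijOn_image
    (fun h => hMc (h.mono (subset_compl_comm.1 fun x hx => hx.2.1))) (fun h => hNc (h.mono fun x hx => by
      rintro ⟨y, hy, rfl⟩
      exact hy.2.2 hx))
  refine ⟨g, ?_⟩
  have h1 : ∀ᵐ u ∂P, u ∈ Mᶜ := compl_mem_ae_iff.2 hPM
  have h2 : ∀ᵐ u ∂P, f u ∈ Nᶜ := hf.quasiMeasurePreserving.ae (compl_mem_ae_iff.2 hQN)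
  filter_upwards [hPS, h1, h2] with u hu hu1 hu2
  exact hg ⟨hu, hu1, hu2⟩

/-! ### The Rosenblatt map -/

/-- The conditional law of the `k`-th coordinate given the coordinates before it. -/
noncomputable def coordKernel {d : ℕ} (P : Measure (E d)) [IsFiniteMeasure P] (k : Fin d) :
    Kernel (Fin (k : ℕ) → ℝ) ℝ :=
  condDistrib (fun x : E d => x k) (initialCoords k) P

instance {d : ℕ} (P : Measure (E d)) [IsFiniteMeasure P] (k : Fin d) :
    IsMarkovKernel (coordKernel P k) := by
  unfold coordKernel; infer_instance

theorem measurable_initialCoords {d : ℕ} (k : Fin d) :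
    Measurable (initialCoords k) :=
  measurable_pi_lambda _ fun j => by unfold initialCoords; fun_prop

theorem rosenblatt_apply {d : ℕ} (P : Measure (E d)) [IsFiniteMeasure P] (u : E d) (k : Fin d) :
    rosenblatt P u k =
      quantile (cdf (coordKernel P k (initialCoords k (rosenblatt P u)))) (u k) := by
  change rosenblattCoord P u k = _
  rw [rosenblattCoord]
  rfl

theorem measurable_rosenblatt {d : ℕ} (P : Measure (E d)) [IsFiniteMeasure P] :
    Measurable (rosenblatt P) := by
  have h : ∀ n : ℕ, ∀ k : Fin d, (k : ℕ) = n → Measurable fun u => rosenblatt P u k := by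
    intro n
    induction n using Nat.strong_induction_on with
    | _ n ih =>
      intro k hk
      simp_rw [rosenblatt_apply]
      refine (measurable_quantile_kernel (coordKernel P k)).comp (Measurable.prodMk ?_ (by fun_prop))
      exact measurable_pi_lambda _ fun j => ih j (hk ▸ j.2) ⟨j, j.2.trans k.2⟩ rfl
  exact (MeasurableEquiv.toLp 2 (Fin d → ℝ)).measurable.comp
    (measurable_pi_lambda _ fun k => h k k rfl)

theorem isTriangular_rosenblatt {d : ℕ} (P : Measure (E d)) [IsFiniteMeasure P] :
    IsTriangular (rosenblatt P) := by
  have h : ∀ n : ℕ, ∀ k : Fin d, (k : ℕ) = n → ∀ u v : E d, (∀ j ≤ k, u j = v j) →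
      rosenblatt P u k = rosenblatt P v k := by
    intro n
    induction n using Nat.strong_induction_on with
    | _ n ih =>
      intro k hk u v huv
      have h1 : initialCoords k (rosenblatt P u) = initialCoords k (rosenblatt P v) := by
        funext j
        have hj : (⟨j, j.2.trans k.2⟩ : Fin d) ≤ k := Fin.le_def.2 j.2.le
        exact ih j (hk ▸ j.2) _ rfl u v fun i hi => huv i (hi.trans hj)
      rw [rosenblatt_apply, rosenblatt_apply, h1, huv k le_rfl]
  exact fun k => h k k rfl

theorem unifCube_eq_map {d : ℕ} : unifCube d =
    (Measure.pi fun _ : Fin d => (volume : Measure ℝ).restrict (Icc 0 1)).map (WithLp.toLp 2) := by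
  have hv := PiLp.volume_preserving_toLp (Fin d)
  have hs : MeasurableSet {u : E d | ∀ i, u i ∈ Icc (0 : ℝ) 1} := by
    rw [ofPred_forall]
    exact MeasurableSet.iInter fun i => (by fun_prop : Measurable fun u : E d => u i)
      measurableSet_Icc
  rw [unifCube, ← (hv.restrict_preimage hs).map_eq, ← Measure.restrict_pi_pi, ← volume_pi]
  congr 2
  ext u
  simp [Pi.le_def, forall_and]

instance isProbabilityMeasure_unifCube {d : ℕ} : IsProbabilityMeasure (unifCube d) := by
  rw [unifCube_eq_map]
  exact Measure.isProbabilityMeasure_map (by fun_prop)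

theorem unifCube_absolutelyContinuous {d : ℕ} : unifCube d ≪ volume :=
  Measure.absolutelyContinuous_of_le Measure.restrict_le_self

theorem map_coord_unifCube {d : ℕ} (k : Fin d) :
    (unifCube d).map (fun u => u k) = (volume : Measure ℝ).restrict (Icc 0 1) := by
  rw [unifCube_eq_map, Measure.map_map (by fun_prop) (by fun_prop)]
  exact (measurePreserving_eval
    (fun _ : Fin d => (volume : Measure ℝ).restrict (Icc 0 1)) k).map_eq

theorem iIndepFun_coord_unifCube {d : ℕ} :
    iIndepFun (fun (i : Fin d) (u : E d) => u i) (unifCube d) := by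
  rw [iIndepFun_iff_map_fun_eq_pi_map fun i => by fun_prop]
  simp_rw [map_coord_unifCube]
  rw [unifCube_eq_map, Measure.map_map (by fun_prop) (by fun_prop)]
  exact Measure.map_id

/-- By triangularity the earlier outputs are functions of the earlier inputs alone, which are
independent of `u k`. -/
theorem indepFun_initialCoords_rosenblatt {d : ℕ} (P : Measure (E d)) [IsFiniteMeasure P]
    (k : Fin d) :
    IndepFun (fun u => initialCoords k (rosenblatt P u)) (fun u => u k) (unifCube d) := by
  have h := iIndepFun_coord_unifCube.indepFun_finset (Finset.univ.filter (· < k)) {k}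
    (by simp) (fun i => by fun_prop)
  -- Missing coordinates are padded with `0`; triangularity makes the padding invisible before index
  -- `k`.
  let ext : (Finset.univ.filter (· < k) → ℝ) → E d := fun a =>
    WithLp.toLp 2 fun i => if hi : i < k then a ⟨i, by simpa using hi⟩ else 0
  have hext : Measurable ext := by
    refine (MeasurableEquiv.toLp 2 (Fin d → ℝ)).measurable.comp (measurable_pi_lambda _ fun i => ?_)
    by_cases hi : i < k
    · simp only [hi, dite_true]; fun_prop
    · simp only [hi, dite_false]; fun_prop
  have hφ : Measurable fun a => initialCoords k (rosenblatt P (ext a)) :=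
    (measurable_initialCoords k).comp ((measurable_rosenblatt P).comp hext)
  have hψ : Measurable fun b : ({k} : Finset (Fin d)) → ℝ => b ⟨k, by simp⟩ :=
    measurable_pi_apply _
  have h' := h.comp hφ hψ
  refine h'.congr (Eventually.of_forall fun u => ?_) (Eventually.of_forall fun u => rfl)
  funext j
  refine isTriangular_rosenblatt P _ _ _ fun i hi => ?_
  have hik : i < k := lt_of_le_of_lt hi (Fin.lt_def.2 j.2)
  simp [ext, hik]

theorem map_initialCoords_prod {d : ℕ} (P : Measure (E d)) [IsProbabilityMeasure P] (k : Fin d) :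
    P.map (fun x => (initialCoords k x, x k)) =
      (P.map (initialCoords k)).compProd (coordKernel P k) :=
  (compProd_map_condDistrib (X := initialCoords k) (Y := fun x : E d => x k) (μ := P)
    (by fun_prop)).symm

/-- The first `n` coordinates of a vector. -/
def firstCoords {d : ℕ} (n : ℕ) (hn : n ≤ d) (x : E d) : Fin n → ℝ :=
  fun j => x ⟨j, j.2.trans_le hn⟩

theorem measurable_firstCoords {d : ℕ} (n : ℕ) (hn : n ≤ d) :
    Measurable (firstCoords (d := d) n hn) :=
  measurable_pi_lambda _ fun j => by unfold firstCoords; fun_prop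

theorem measurable_snoc (n : ℕ) :
    Measurable fun x : (Fin n → ℝ) × ℝ => (Fin.snoc x.1 x.2 : Fin (n + 1) → ℝ) := by
  refine measurable_pi_lambda _ fun i => ?_
  refine Fin.lastCases ?_ (fun j => ?_) i
  · simpa using measurable_snd
  · simp only [Fin.snoc_castSucc]; fun_prop

theorem firstCoords_succ {d : ℕ} (n : ℕ) (hn : n + 1 ≤ d) (x : E d) :
    firstCoords (n + 1) hn x =
      (Fin.snoc (initialCoords ⟨n, hn⟩ x) (x ⟨n, hn⟩) : Fin (n + 1) → ℝ) := by
  funext i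
  refine Fin.lastCases ?_ (fun j => ?_) i
  · rw [Fin.snoc_last]; rfl
  · rw [Fin.snoc_castSucc]; rfl

/-- The induction step: the earlier outputs and the fresh level have a product law, and conditional
sampling turns it into the disintegration of `P`. -/
theorem map_initialCoords_prod_rosenblatt {d : ℕ} (P : Measure (E d)) [IsProbabilityMeasure P]
    (k : Fin d) (h : (unifCube d).map (fun u => initialCoords k (rosenblatt P u)) =
      P.map (initialCoords k)) :
    (unifCube d).map (fun u => (initialCoords k (rosenblatt P u), rosenblatt P u k)) =
      P.map (fun x => (initialCoords k x, x k)) := by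
  have hiR : Measurable fun u => initialCoords k (rosenblatt P u) :=
    (measurable_initialCoords k).comp (measurable_rosenblatt P)
  have hind := (indepFun_initialCoords_rosenblatt P k).map_prod_eq_prod_map_map
    hiR.aemeasurable (by fun_prop)
  rw [h, map_coord_unifCube] at hind
  have hq : Measurable fun x : (Fin (k : ℕ) → ℝ) × ℝ =>
      (x.1, quantile (cdf (coordKernel P k x.1)) x.2) :=
    measurable_fst.prodMk (measurable_quantile_kernel _)
  rw [map_initialCoords_prod, ← map_prod_quantile, ← hind,
    Measure.map_map hq (hiR.prodMk (by fun_prop))]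
  congr 1
  funext u
  simp only [Function.comp]
  rw [← rosenblatt_apply]

theorem map_firstCoords_rosenblatt {d : ℕ} (P : Measure (E d)) [IsProbabilityMeasure P]
    (n : ℕ) (hn : n ≤ d) :
    (unifCube d).map (fun u => firstCoords n hn (rosenblatt P u)) =
      P.map (firstCoords n hn) := by
  have hR := measurable_rosenblatt P
  induction n with
  | zero =>
    -- There is only one empty tuple, so two probability measures on it agree.
    have h1 := Measure.isProbabilityMeasure_map (μ := unifCube d)
      ((measurable_firstCoords 0 hn).comp hR).aemeasurable
    have h2 := Measure.isProbabilityMeasure_map (μ := P)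
      (measurable_firstCoords 0 hn).aemeasurable
    ext s hs
    rcases s.eq_empty_or_nonempty with rfl | hne
    · simp
    · obtain rfl := Subsingleton.eq_univ_of_nonempty hne
      exact h1.measure_univ.trans h2.measure_univ.symm
  | succ n ih =>
    have hi := measurable_initialCoords (⟨n, hn⟩ : Fin d)
    have hiR : Measurable fun u => (initialCoords ⟨n, hn⟩ (rosenblatt P u),
        rosenblatt P u ⟨n, hn⟩) :=
      (hi.comp hR).prodMk ((by fun_prop : Measurable fun x : E d => x ⟨n, hn⟩).comp hR)
    have hpair := map_initialCoords_prod_rosenblatt P ⟨n, hn⟩ (ih (Nat.le_of_succ_le hn))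
    have h := congrArg (Measure.map
      fun x : (Fin n → ℝ) × ℝ => (Fin.snoc x.1 x.2 : Fin (n + 1) → ℝ)) hpair
    rw [Measure.map_map (measurable_snoc n) hiR,
      Measure.map_map (measurable_snoc n) (hi.prodMk (by fun_prop))] at h
    convert h using 2
    · funext u; exact firstCoords_succ n hn _
    · funext u; exact firstCoords_succ n hn _

theorem measurePreserving_rosenblatt {d : ℕ} (P : Measure (E d)) [IsProbabilityMeasure P] :
    MeasurePreserving (rosenblatt P) (unifCube d) P := by
  refine ⟨measurable_rosenblatt P, ?_⟩
  have hm := measurable_firstCoords d le_rfl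
  have ht : Measurable (WithLp.toLp 2 : (Fin d → ℝ) → E d) := by fun_prop
  have h : ((unifCube d).map (firstCoords d le_rfl ∘ rosenblatt P)).map (WithLp.toLp 2) =
      (P.map (firstCoords d le_rfl)).map (WithLp.toLp 2) :=
    congrArg _ (map_firstCoords_rosenblatt P d le_rfl)
  rw [Measure.map_map ht (hm.comp (measurable_rosenblatt P)), Measure.map_map ht hm] at h
  exact h.trans Measure.map_id

/-- A surjective linear map sends Lebesgue null sets back to null sets, so the joint law of these
coordinates is absolutely continuous and its disintegration has no atoms. -/
theorem ae_nullSingletonClass_coordKernel {d : ℕ} (P : Measure (E d)) [IsProbabilityMeasure P]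
    (hP : P ≪ volume) (k : Fin d) :
    ∀ᵐ a ∂(P.map (initialCoords k)), NullSingletonClass (coordKernel P k a) := by
  refine ae_nullSingletonClass_of_compProd (ν := volume) _ ?_
  rw [← map_initialCoords_prod]
  let L : E d →ₗ[ℝ] (Fin (k : ℕ) → ℝ) × ℝ :=
    { toFun := fun x => (initialCoords k x, x k)
      map_add' := fun x y => rfl
      map_smul' := fun c x => rfl }
  have hL : Function.Surjective L := by
    rintro ⟨a, t⟩
    refine ⟨WithLp.toLp 2 fun i => if hi : (i : ℕ) < k then a ⟨i, hi⟩ else t, ?_⟩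
    refine Prod.ext (funext fun j => ?_) ?_
    · change (if hi : (j : ℕ) < k then a ⟨j, hi⟩ else t) = a j
      simp
    · change (if hi : (k : ℕ) < k then a ⟨k, hi⟩ else t) = t
      simp
  have hq : Measure.QuasiMeasurePreserving L volume
      ((volume : Measure (Fin (k : ℕ) → ℝ)).prod volume) := by
    obtain ⟨c, -, hc⟩ := L.exists_map_addHaar_eq_smul_addHaar volume
      ((volume : Measure (Fin (k : ℕ) → ℝ)).prod volume) hL
    refine ⟨L.continuous_of_finiteDimensional.measurable, ?_⟩
    rw [hc]
    exact Measure.smul_absolutelyContinuous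
  exact (hP.map hq.measurable).trans hq.absolutelyContinuous

/-- Injectivity holds because `u k` is the conditional distribution function evaluated at the
output's own coordinates. -/
theorem isBijectiveAE_rosenblatt {d : ℕ} (P : Measure (E d)) [IsProbabilityMeasure P]
    (hP : P ≪ volume) : IsBijectiveAE (unifCube d) P (rosenblatt P) := by
  have hR := measurePreserving_rosenblatt P
  have h1 : ∀ᵐ u ∂(unifCube d), ∀ k : Fin d, u k ∈ Ioo (0 : ℝ) 1 := by
    refine ae_all_iff.2 fun k => ?_
    have h := ae_mem_Ioo_restrict_Icc
    rw [← map_coord_unifCube k] at h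
    exact ae_of_ae_map (by fun_prop) h
  have h2 : ∀ᵐ u ∂(unifCube d), ∀ k : Fin d,
      NullSingletonClass (coordKernel P k (initialCoords k (rosenblatt P u))) := by
    refine ae_all_iff.2 fun k => ?_
    exact hR.quasiMeasurePreserving.ae (ae_of_ae_map (measurable_initialCoords k).aemeasurable
      (ae_nullSingletonClass_coordKernel P hP k))
  obtain ⟨S, hSsub, hS, hS1⟩ := exists_measurable_superset_of_null (ae_iff.1 (h1.and h2))
  refine IsBijectiveAE.of_injOn hR hS.compl (compl_mem_ae_iff.2 hS1) fun u hu v hv huv => ?_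
  have hu' := not_not.1 fun h => hu (hSsub h)
  have hv' := not_not.1 fun h => hv (hSsub h)
  ext k
  have := hu'.2 k
  have := hv'.2 k
  rw [← cdf_quantile (coordKernel P k (initialCoords k (rosenblatt P u))) (hu'.1 k),
    ← rosenblatt_apply, huv]
  rw [← cdf_quantile (coordKernel P k (initialCoords k (rosenblatt P v))) (hv'.1 k),
    ← rosenblatt_apply]

theorem transportEquiv_rosenblatt {d : ℕ} (P : Measure (E d)) [IsProbabilityMeasure P]
    (hP : P ≪ volume) {k : ℕ} (T : E d → E k → E d) :
    TransportEquiv T P (fun u pa => T (rosenblatt P u) pa) (unifCube d) := by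
  have hR := measurePreserving_rosenblatt P
  have key : ∃ g : E d ≃ᵐ E d, g =ᵐ[unifCube d] rosenblatt P := by
    rcases Nat.eq_zero_or_pos d with rfl | hd
    -- Dimension `0` has no uncountable null set, but there the space is a single point.
    · exact ⟨MeasurableEquiv.refl _, Eventually.of_forall fun u => Subsingleton.elim _ _⟩
    · exact exists_measurableEquiv_ae_eq hd unifCube_absolutelyContinuous hP hR
        (isBijectiveAE_rosenblatt P hP)
  obtain ⟨g, hg⟩ := key
  have hgP : (unifCube d).map g = P := by rw [Measure.map_congr hg, hR.map_eq]
  refine ⟨g, hgP, ?_⟩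
  suffices h : ∀ᵐ u ∂((unifCube d).map g), ∀ pa, T u pa = T (rosenblatt P (g.symm u)) pa by
    rwa [hgP] at h
  refine g.measurableEmbedding.ae_map_iff.2 ?_
  filter_upwards [hg] with u hu pa
  rw [MeasurableEquiv.symm_apply_apply, hu]

/-! ### Optimal couplings -/

section Couplings

variable {X Y : Type*} [MeasurableSpace X] [MeasurableSpace Y]

/-- `γ` has marginals `P` and `Q` and minimizes the integral of the cost `c` among all measures
with these marginals. -/
def IsOptimalCoupling (c : X × Y → ℝ) (P : Measure X) (Q : Measure Y) (γ : Measure (X × Y)) :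
    Prop :=
  γ.fst = P ∧ γ.snd = Q ∧ ∀ γ' : Measure (X × Y), γ'.fst = P → γ'.snd = Q →
    ∫⁻ z, ENNReal.ofReal (c z) ∂γ ≤ ∫⁻ z, ENNReal.ofReal (c z) ∂γ'

theorem ofReal_le_lintegral_add {c : X × Y → ℝ} {μ : Measure (X × Y)} [IsProbabilityMeasure μ]
    {a ε : ℝ} (h : ∀ᵐ z ∂μ, a ≤ c z + ε) :
    ENNReal.ofReal a ≤ ∫⁻ z, ENNReal.ofReal (c z) ∂μ + ENNReal.ofReal ε := by
  have : ∫⁻ _, ENNReal.ofReal a ∂μ ≤ ∫⁻ z, ENNReal.ofReal (c z) + ENNReal.ofReal ε ∂μ :=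
    lintegral_mono_ae (h.mono fun z hz =>
      (ENNReal.ofReal_le_ofReal hz).trans ENNReal.ofReal_add_le)
  rwa [lintegral_add_right _ measurable_const, lintegral_const, lintegral_const, measure_univ,
    mul_one, mul_one] at this

variable [TopologicalSpace X] [TopologicalSpace Y]

/-- The integral is the supremum of those of the bounded truncations `min f n`, each weakly
continuous in the measure. -/
theorem lowerSemicontinuous_lintegral [OpensMeasurableSpace X] {f : X → ℝ≥0} (hf : Continuous f) :
    LowerSemicontinuous fun μ : ProbabilityMeasure X => ∫⁻ x, f x ∂(μ : Measure X) := by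
  have h : (fun μ : ProbabilityMeasure X => ∫⁻ x, f x ∂(μ : Measure X)) =
      fun μ : ProbabilityMeasure X =>
        ⨆ n : ℕ, ∫⁻ x, ((min (f x) (n : ℝ≥0) : ℝ≥0) : ℝ≥0∞) ∂(μ : Measure X) := by
    funext μ
    rw [← lintegral_iSup (fun n => by fun_prop)
      (fun n m hnm x => by
        simp only [ENNReal.coe_le_coe]
        exact min_le_min le_rfl (by exact_mod_cast hnm))]
    refine lintegral_congr fun x => le_antisymm ?_ (iSup_le fun n => by simp)
    obtain ⟨n, hn⟩ := exists_nat_ge (f x)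
    refine le_iSup_of_le n ?_
    rw [min_eq_left hn]
  rw [h]
  refine lowerSemicontinuous_iSup fun n => Continuous.lowerSemicontinuous ?_
  let g : X →ᵇ ℝ≥0 := BoundedContinuousFunction.mkOfBound
    ⟨fun x => min (f x) (n : ℝ≥0), by fun_prop⟩ n (fun x y => by
      simp only [ContinuousMap.coe_mk, NNReal.dist_eq]
      have h1 : ((min (f x) (n : ℝ≥0) : ℝ≥0) : ℝ) ≤ n := by exact_mod_cast min_le_right _ _
      have h2 : ((min (f y) (n : ℝ≥0) : ℝ≥0) : ℝ) ≤ n := by exact_mod_cast min_le_right _ _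
      rw [abs_le]
      constructor <;> linarith [(min (f x) (n : ℝ≥0)).2, (min (f y) (n : ℝ≥0)).2])
  refine continuous_iff_continuousAt.2 fun μ => ?_
  exact (ProbabilityMeasure.tendsto_iff_forall_lintegral_tendsto.1 tendsto_id) g

/-- Existence of an optimal coupling. -/
theorem exists_isOptimalCoupling [PolishSpace X] [PolishSpace Y] [BorelSpace X] [BorelSpace Y]
    {c : X × Y → ℝ} (hc : Continuous c) (P : Measure X) (Q : Measure Y)
    [IsProbabilityMeasure P] [IsProbabilityMeasure Q] :
    ∃ γ, IsOptimalCoupling c P Q γ := by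
  let P' : ProbabilityMeasure X := ⟨P, inferInstance⟩
  let Q' : ProbabilityMeasure Y := ⟨Q, inferInstance⟩
  let S : Set (ProbabilityMeasure (X × Y)) :=
    {γ | γ.map measurable_fst.aemeasurable = P' ∧ γ.map measurable_snd.aemeasurable = Q'}
  have hSiff : ∀ γ : ProbabilityMeasure (X × Y), γ ∈ S ↔
      (γ : Measure (X × Y)).fst = P ∧ (γ : Measure (X × Y)).snd = Q := fun γ =>
    and_congr Subtype.ext_iff Subtype.ext_iff
  have hclosed : IsClosed S :=
    (isClosed_eq (ProbabilityMeasure.continuous_map continuous_fst) continuous_const).inter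
      (isClosed_eq (ProbabilityMeasure.continuous_map continuous_snd) continuous_const)
  -- Prokhorov: couplings are tight because each marginal is one fixed tight measure.
  have htight : IsTightMeasureSet {((γ : ProbabilityMeasure (X × Y)) : Measure (X × Y)) | γ ∈ S} := by
    refine IsTightMeasureSet.prodMk
      ((isTightMeasureSet_singleton (μ := P)).subset ?_)
      ((isTightMeasureSet_singleton (μ := Q)).subset ?_)
    · rintro _ ⟨_, ⟨γ, hγ, rfl⟩, rfl⟩
      exact ((hSiff γ).1 hγ).1
    · rintro _ ⟨_, ⟨γ, hγ, rfl⟩, rfl⟩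
      exact ((hSiff γ).1 hγ).2
  have hcomp : IsCompact S := by
    have := isCompact_closure_of_isTightMeasureSet htight
    rwa [hclosed.closure_eq] at this
  have hne : S.Nonempty := ⟨⟨P.prod Q, inferInstance⟩, (hSiff _).2 (by simp)⟩
  obtain ⟨γ, hγ, hmin⟩ := ((lowerSemicontinuous_lintegral (X := X × Y)
    (f := fun z => (c z).toNNReal) (by fun_prop)).lowerSemicontinuousOn S).exists_isMinOn hne hcomp
  refine ⟨γ, ((hSiff γ).1 hγ).1, ((hSiff γ).1 hγ).2, fun γ' h1 h2 => ?_⟩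
  have : IsProbabilityMeasure γ' := ⟨by
    rw [← Measure.fst_univ, h1, measure_univ]⟩
  exact hmin ((hSiff ⟨γ', this⟩).2 ⟨h1, h2⟩)

/-- The support of an optimal coupling of finite cost is cyclically monotone. -/
theorem IsOptimalCoupling.sum_le_sum_perm [SecondCountableTopology X] [SecondCountableTopology Y]
    [BorelSpace X] [BorelSpace Y] {c : X × Y → ℝ} (hc : Continuous c) (hc0 : ∀ z, 0 ≤ c z)
    {P : Measure X} {Q : Measure Y} {γ : Measure (X × Y)} [IsFiniteMeasure γ]
    (hγ : IsOptimalCoupling c P Q γ) (hfin : ∫⁻ z, ENNReal.ofReal (c z) ∂γ ≠ ∞)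
    {ι : Type*} [Fintype ι] (x : ι → X) (y : ι → Y) (σ : Equiv.Perm ι)
    (hxy : ∀ i, (x i, y i) ∈ γ.support) :
    ∑ i, c (x i, y i) ≤ ∑ i, c (x i, y (σ i)) := by
  rcases isEmpty_or_nonempty ι with hι | hι
  · simp
  -- A little mass near each `(x i, y i)` is rerouted along `σ`; optimality compares the costs up to
  -- `ε`.
  have key : ∀ ε : ℝ, 0 < ε → ∑ i, ENNReal.ofReal (c (x i, y i)) ≤
      ∑ i, (ENNReal.ofReal (c (x i, y (σ i)) + ε) + ENNReal.ofReal ε) := by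
    intro ε hε
    have hnhds : ∀ i j, ∃ A ∈ 𝓝 (x i), ∃ B ∈ 𝓝 (y j), ∀ a ∈ A, ∀ b ∈ B,
        |c (a, b) - c (x i, y j)| < ε := by
      intro i j
      have := (hc.continuousAt (x := (x i, y j))).eventually (Metric.ball_mem_nhds _ hε)
      rw [nhds_prod_eq, eventually_prod_iff] at this
      obtain ⟨p, hp, q, hq, h⟩ := this
      exact ⟨{a | p a}, hp, {b | q b}, hq, fun a ha b hb => h ha hb⟩
    choose A hA B hB hAB using hnhds
    let U : ι → Set X := fun i => interior (⋂ j, A i j)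
    let V : ι → Set Y := fun j => interior (⋂ i, B i j)
    have hU : ∀ i, U i ∈ 𝓝 (x i) := fun i => interior_mem_nhds.2 (iInter_mem.2 (hA i))
    have hV : ∀ j, V j ∈ 𝓝 (y j) := fun j => interior_mem_nhds.2 (iInter_mem.2 fun i => hB i j)
    have hUV : ∀ i j, ∀ a ∈ U i, ∀ b ∈ V j, |c (a, b) - c (x i, y j)| < ε := fun i j a ha b hb =>
      hAB i j a (mem_iInter.1 (interior_subset ha) j) b (mem_iInter.1 (interior_subset hb) i)
    have hUm : ∀ i, MeasurableSet (U i) := fun i => isOpen_interior.measurableSet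
    have hVm : ∀ i, MeasurableSet (V i) := fun i => isOpen_interior.measurableSet
    let W : ι → Set (X × Y) := fun i => U i ×ˢ V i
    have hWm : ∀ i, MeasurableSet (W i) := fun i => (hUm i).prod (hVm i)
    have hpos : ∀ i, 0 < γ (W i) := fun i =>
      Measure.mem_support_iff_forall (x i, y i) |>.1 (hxy i) _ (prod_mem_nhds (hU i) (hV i))
    let μ : ι → Measure (X × Y) := fun i => γ[|W i]
    have hμ : ∀ i, IsProbabilityMeasure (μ i) := fun i => cond_isProbabilityMeasure (hpos i).ne'
    have hμW : ∀ i, ∀ᵐ z ∂(μ i), z ∈ W i := fun i => ae_cond_mem (hWm i)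
    let N : ℝ≥0∞ := Fintype.card ι
    have hN0 : N ≠ 0 := by simp [N]
    have hNtop : N ≠ ∞ := by simp [N]
    obtain ⟨i₀, hi₀⟩ := Finite.exists_min fun i => γ (W i)
    -- The least box mass divided by the number of boxes: small enough that `κ ≤ γ` even if boxes
    -- overlap.
    let t : ℝ≥0∞ := N⁻¹ * γ (W i₀)
    have ht0 : t ≠ 0 := mul_ne_zero (ENNReal.inv_ne_zero.2 hNtop) (hpos i₀).ne'
    have httop : t ≠ ∞ := ENNReal.mul_ne_top (ENNReal.inv_ne_top.2 hN0) (measure_ne_top _ _)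
    let κ : Measure (X × Y) := ∑ i, t • μ i
    have hκle : κ ≤ γ := by
      have h1 : ∀ i, t • μ i ≤ N⁻¹ • γ := by
        intro i
        refine Measure.le_iff.2 fun s hs => ?_
        simp only [Measure.smul_apply, smul_eq_mul, μ, t, cond_apply (hWm i)]
        rw [mul_assoc]
        refine mul_le_mul_right ?_ _
        rw [← mul_assoc]
        calc γ (W i₀) * (γ (W i))⁻¹ * γ (W i ∩ s)
            ≤ γ (W i) * (γ (W i))⁻¹ * γ s :=
              mul_le_mul' (mul_le_mul' (hi₀ i) le_rfl) (measure_mono inter_subset_right)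
          _ = γ s := by
              rw [ENNReal.mul_inv_cancel (hpos i).ne' (measure_ne_top _ _), one_mul]
      calc κ ≤ ∑ _i : ι, N⁻¹ • γ := Finset.sum_le_sum fun i _ => h1 i
        _ = γ := by
          rw [Finset.sum_const, Finset.card_univ, ← Nat.cast_smul_eq_nsmul ℝ≥0∞, smul_smul,
            ENNReal.mul_inv_cancel hN0 hNtop, one_smul]
    have : IsFiniteMeasure κ := isFiniteMeasure_of_le γ hκle
    let ρ := γ - κ
    have hρ : ρ + κ = γ := Measure.sub_add_cancel_of_le hκle
    -- Sources of box `i` are paired with targets of box `σ i`; summed over `i`, the marginals are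
    -- unchanged.
    let π : ι → Measure (X × Y) := fun i => (μ i).fst.prod (μ (σ i)).snd
    let κ' : Measure (X × Y) := ∑ i, t • π i
    have hfst : κ'.fst = κ.fst := by
      simp only [κ, κ', Measure.fst]
      rw [Measure.map_finset_sum' (by fun_prop), Measure.map_finset_sum' (by fun_prop)]
      refine Finset.sum_congr rfl fun i _ => ?_
      rw [Measure.map_smul, Measure.map_smul]
      congr 1
      exact Measure.fst_prod
    have hsnd : κ'.snd = κ.snd := by
      simp only [κ, κ', Measure.snd]
      rw [Measure.map_finset_sum' (by fun_prop), Measure.map_finset_sum' (by fun_prop)]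
      rw [← Equiv.sum_comp σ fun i => Measure.map Prod.snd (t • μ i)]
      refine Finset.sum_congr rfl fun i _ => ?_
      rw [Measure.map_smul, Measure.map_smul]
      congr 1
      exact Measure.snd_prod
    have hle := hγ.2.2 (ρ + κ')
      (by rw [Measure.fst_add, hfst, ← Measure.fst_add, hρ, hγ.1])
      (by rw [Measure.snd_add, hsnd, ← Measure.snd_add, hρ, hγ.2.1])
    rw [← hρ, lintegral_add_measure, lintegral_add_measure] at hle
    have hρfin : ∫⁻ z, ENNReal.ofReal (c z) ∂ρ ≠ ∞ := by
      refine ne_top_of_le_ne_top hfin (lintegral_mono' ?_ le_rfl)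
      exact Measure.sub_le
    -- Finiteness of the cost allows the untouched part `ρ` to be cancelled.
    have hle2 := (ENNReal.add_le_add_iff_left hρfin).1 hle
    simp only [κ, κ', lintegral_finsetSum_measure, lintegral_smul_measure, smul_eq_mul,
      ← Finset.mul_sum] at hle2
    have hle3 := (ENNReal.mul_le_mul_iff_right ht0 httop).1 hle2
    have h1 : ∀ i, ENNReal.ofReal (c (x i, y i)) ≤
        ∫⁻ z, ENNReal.ofReal (c z) ∂(μ i) + ENNReal.ofReal ε := by
      intro i
      refine ofReal_le_lintegral_add ((hμW i).mono fun z hz => ?_)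
      have := abs_lt.1 (hUV i i z.1 hz.1 z.2 hz.2)
      linarith [this.1]
    have h2 : ∀ i, ∫⁻ z, ENNReal.ofReal (c z) ∂(π i) ≤
        ENNReal.ofReal (c (x i, y (σ i)) + ε) := by
      intro i
      have hz1 : ∀ᵐ a ∂(μ i).fst, a ∈ U i :=
        (ae_map_iff measurable_fst.aemeasurable (hUm i)).2 ((hμW i).mono fun z hz => hz.1)
      have hz2 : ∀ᵐ b ∂(μ (σ i)).snd, b ∈ V (σ i) :=
        (ae_map_iff measurable_snd.aemeasurable (hVm _)).2 ((hμW (σ i)).mono fun z hz => hz.2)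
      have hz : ∀ᵐ z ∂(π i), z.1 ∈ U i ∧ z.2 ∈ V (σ i) :=
        (Measure.quasiMeasurePreserving_fst.ae hz1).and (Measure.quasiMeasurePreserving_snd.ae hz2)
      calc ∫⁻ z, ENNReal.ofReal (c z) ∂(π i)
          ≤ ∫⁻ _, ENNReal.ofReal (c (x i, y (σ i)) + ε) ∂(π i) :=
            lintegral_mono_ae (hz.mono fun z hz => ENNReal.ofReal_le_ofReal (by
              have := abs_lt.1 (hUV i (σ i) z.1 hz.1 z.2 hz.2)
              linarith [this.2]))
        _ = _ := by simp
    calc ∑ i, ENNReal.ofReal (c (x i, y i))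
        ≤ ∑ i, (∫⁻ z, ENNReal.ofReal (c z) ∂(μ i) + ENNReal.ofReal ε) :=
          Finset.sum_le_sum fun i _ => h1 i
      _ = ∑ i, ∫⁻ z, ENNReal.ofReal (c z) ∂(μ i) + ∑ _i : ι, ENNReal.ofReal ε :=
          Finset.sum_add_distrib
      _ ≤ ∑ i, ∫⁻ z, ENNReal.ofReal (c z) ∂(π i) + ∑ _i : ι, ENNReal.ofReal ε := by gcongr
      _ ≤ ∑ i, ENNReal.ofReal (c (x i, y (σ i)) + ε) + ∑ _i : ι, ENNReal.ofReal ε := by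
          gcongr with i; exact h2 i
      _ = _ := Finset.sum_add_distrib.symm
  have key' : ∀ ε : ℝ, 0 < ε → ∑ i, c (x i, y i) ≤
      ∑ i, c (x i, y (σ i)) + Fintype.card ι * (2 * ε) := by
    intro ε hε
    have h := key ε hε
    have h3 : ∀ i, ENNReal.ofReal (c (x i, y (σ i)) + ε) + ENNReal.ofReal ε =
        ENNReal.ofReal (c (x i, y (σ i)) + 2 * ε) := by
      intro i
      rw [← ENNReal.ofReal_add (by linarith [hc0 (x i, y (σ i))]) hε.le]
      congr 1; ring
    simp_rw [h3] at h
    rw [← ENNReal.ofReal_sum_of_nonneg fun i _ => hc0 _,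
      ← ENNReal.ofReal_sum_of_nonneg fun i _ => by linarith [hc0 (x i, y (σ i))],
      ENNReal.ofReal_le_ofReal_iff (Finset.sum_nonneg fun i _ => by
        linarith [hc0 (x i, y (σ i))]), Finset.sum_add_distrib, Finset.sum_const,
      Finset.card_univ, nsmul_eq_mul] at h
    exact h
  have hN : (0 : ℝ) < Fintype.card ι := by exact_mod_cast Fintype.card_pos
  refine le_of_forall_pos_le_add fun δ hδ => ?_
  have := key' (δ / (2 * Fintype.card ι)) (by positivity)
  calc _ ≤ _ := this
    _ = _ := by field_simp

end Couplings

/-! ### Cyclically monotone sets and convex potentials -/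

section Rockafellar

variable {H : Type*} [NormedAddCommGroup H] [InnerProductSpace ℝ H]

/-- Rearranging finitely many points of the set does not increase the sum of inner products. -/
def IsCyclicallyMonotone (Γ : Set (H × H)) : Prop :=
  ∀ (n : ℕ) (p : Fin n → H × H) (σ : Equiv.Perm (Fin n)), (∀ i, p i ∈ Γ) →
    ∑ i, ⟪(p i).1, (p (σ i)).2⟫ ≤ ∑ i, ⟪(p i).1, (p i).2⟫

/-- The affine function obtained by following the slopes `(p i).2` along the chain of base points
`(p i).1` for `i ≤ n`. -/
noncomputable def chainAffine (p : ℕ → H × H) (n : ℕ) (z : H) : ℝ :=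
  ∑ i ∈ Finset.range n, ⟪(p (i + 1)).1 - (p i).1, (p i).2⟫ + ⟪z - (p n).1, (p n).2⟫

/-- Closing the chain at its starting point pairs each slope with the next base point, a cyclic
rearrangement. -/
theorem chainAffine_le_zero {Γ : Set (H × H)} (hΓ : IsCyclicallyMonotone Γ) {p : ℕ → H × H}
    (hp : ∀ i, p i ∈ Γ) (n : ℕ) : chainAffine p n (p 0).1 ≤ 0 := by
  have h := hΓ (n + 1) (fun i => p i) (finRotate (n + 1)).symm (fun i => hp i)
  rw [← Equiv.sum_comp (finRotate (n + 1))] at h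
  simp only [Equiv.symm_apply_apply] at h
  rw [Fin.sum_univ_castSucc, Fin.sum_univ_castSucc, finRotate_last] at h
  have h1 : ∀ i : Fin n, ((finRotate (n + 1) i.castSucc : Fin (n + 1)) : ℕ) = i + 1 := by
    intro i
    rw [finRotate_apply, Fin.coeSucc_eq_succ, Fin.val_succ]
  simp only [h1, Fin.val_castSucc, Fin.val_last, Fin.val_zero] at h
  rw [Fin.sum_univ_eq_sum_range (fun i => ⟪(p (i + 1)).1, (p i).2⟫) n,
    Fin.sum_univ_eq_sum_range (fun i => ⟪(p i).1, (p i).2⟫) n] at h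
  simp only [chainAffine, inner_sub_left, Finset.sum_sub_distrib]
  linarith

theorem chainAffine_convexCombination (p : ℕ → H × H) (n : ℕ) (u v : H) {a b : ℝ}
    (hab : a + b = 1) :
    chainAffine p n (a • u + b • v) = a * chainAffine p n u + b * chainAffine p n v := by
  simp only [chainAffine, inner_sub_left, inner_add_left, real_inner_smul_left]
  obtain rfl : b = 1 - a := by linarith
  ring

/-- Appending `q` to chains is what makes `q.2` a subgradient of their supremum at `q.1`. -/
theorem chainAffine_extend (p : ℕ → H × H) (n : ℕ) (q : H × H) (z : H) :
    chainAffine (fun i => if i ≤ n then p i else q) (n + 1) z =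
      chainAffine p n q.1 + ⟪z - q.1, q.2⟫ := by
  simp only [chainAffine, Finset.sum_range_succ]
  have h : ∀ i ∈ Finset.range n,
      (⟪(if i + 1 ≤ n then p (i + 1) else q).1 - (if i ≤ n then p i else q).1,
        (if i ≤ n then p i else q).2⟫ : ℝ) = ⟪(p (i + 1)).1 - (p i).1, (p i).2⟫ := by
    intro i hi
    have hi' := Finset.mem_range.1 hi
    rw [if_pos (by omega), if_pos (by omega)]
  rw [Finset.sum_congr rfl h]
  simp

/-- Rockafellar's theorem: a cyclically monotone set is contained in the subdifferential of a
convex function. -/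
theorem IsCyclicallyMonotone.exists_convex_potential {Γ : Set (H × H)}
    (hΓ : IsCyclicallyMonotone Γ) (hne : Γ.Nonempty) :
    ∃ (D : Set H) (φ : H → ℝ), ConvexOn ℝ D φ ∧
      ∀ q ∈ Γ, q.1 ∈ D ∧ ∀ z ∈ D, φ q.1 + ⟪z - q.1, q.2⟫ ≤ φ z := by
  obtain ⟨z₀, hz₀⟩ := hne
  -- The potential is the supremum over all chains in `Γ` that start at `z₀`.
  let I := {k : ℕ × (ℕ → H × H) // k.2 0 = z₀ ∧ ∀ i, k.2 i ∈ Γ}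
  have : Nonempty I := ⟨⟨(0, fun _ => z₀), rfl, fun _ => hz₀⟩⟩
  let f : H → I → ℝ := fun z k => chainAffine k.1.2 k.1.1 z
  let D : Set H := {z | BddAbove (range (f z))}
  let φ : H → ℝ := fun z => ⨆ k, f z k
  have hconv : ∀ u ∈ D, ∀ v ∈ D, ∀ a b : ℝ, 0 ≤ a → 0 ≤ b → a + b = 1 → ∀ k,
      f (a • u + b • v) k ≤ a * φ u + b * φ v := by
    intro u hu v hv a b ha hb hab k
    simp only [f]
    rw [chainAffine_convexCombination _ _ _ _ hab]
    exact add_le_add (mul_le_mul_of_nonneg_left (le_ciSup hu k) ha)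
      (mul_le_mul_of_nonneg_left (le_ciSup hv k) hb)
  have hstep : ∀ q ∈ Γ, ∀ k : I, ∃ k' : I, ∀ z, f z k' = f q.1 k + ⟪z - q.1, q.2⟫ := by
    intro q hq k
    refine ⟨⟨(k.1.1 + 1, fun i => if i ≤ k.1.1 then k.1.2 i else q), ?_, fun i => ?_⟩, fun z => ?_⟩
    · simpa using k.2.1
    · dsimp only
      split_ifs
      exacts [k.2.2 i, hq]
    · exact chainAffine_extend _ _ _ _
  refine ⟨D, φ, ⟨fun u hu v hv a b ha hb hab => ⟨a * φ u + b * φ v, ?_⟩,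
    fun u hu v hv a b ha hb hab => ciSup_le (hconv u hu v hv a b ha hb hab)⟩,
    fun q hq => ⟨?_, fun z hz => ?_⟩⟩
  · rintro _ ⟨k, rfl⟩
    exact hconv u hu v hv a b ha hb hab k
  -- Extending a chain by `q` and returning to `z₀` gives a nonpositive value, which bounds the
  -- chain at `q.1`.
  · refine ⟨⟪q.1 - z₀.1, q.2⟫, ?_⟩
    rintro _ ⟨k, rfl⟩
    obtain ⟨k', hk'⟩ := hstep q hq k
    have h1 := chainAffine_le_zero hΓ k'.2.2 k'.1.1
    rw [k'.2.1] at h1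
    have h2 := hk' z₀.1
    simp only [f] at h2 ⊢
    rw [h2] at h1
    rw [← neg_sub z₀.1, inner_neg_left]
    linarith
  · rw [← le_sub_iff_add_le]
    refine ciSup_le fun k => ?_
    obtain ⟨k', hk'⟩ := hstep q hq k
    have := le_ciSup hz k'
    rw [hk'] at this
    rw [le_sub_iff_add_le]
    exact this

/-- Subtracting the linear function of slope `y` leaves a local minimum, where the derivative
vanishes. -/
theorem hasGradientAt_of_subgradient [CompleteSpace H] {φ : H → ℝ} {C : Set H} {x y : H}
    (hC : C ∈ 𝓝 x) (hφ : DifferentiableAt ℝ φ x) (h : ∀ z ∈ C, φ x + ⟪z - x, y⟫ ≤ φ z) :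
    HasGradientAt φ y x := by
  have h1 : HasFDerivAt (fun z => φ z - ⟪y, z⟫) (fderiv ℝ φ x - innerSL ℝ y) x :=
    hφ.hasFDerivAt.sub (innerSL ℝ y).hasFDerivAt
  have hmin : IsLocalMin (fun z => φ z - ⟪y, z⟫) x := by
    filter_upwards [hC] with z hz
    have := h z hz
    rw [inner_sub_left, real_inner_comm, real_inner_comm y x] at this
    linarith
  have h2 := hmin.hasFDerivAt_eq_zero h1
  rw [hasGradientAt_iff_hasFDerivAt]
  have h3 : InnerProductSpace.toDual ℝ H y = fderiv ℝ φ x := (sub_eq_zero.1 h2).symm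
  rw [h3]
  exact hφ.hasFDerivAt

end Rockafellar

/-- Difference quotients along the segment from `x` to `z` never exceed `φ z - φ x`. -/
theorem ConvexOn.add_inner_le_of_hasGradientAt {H : Type*} [NormedAddCommGroup H]
    [InnerProductSpace ℝ H] [CompleteSpace H] {φ : H → ℝ} {C : Set H} (hφ : ConvexOn ℝ C φ)
    {x y z : H} (hx : x ∈ C) (hz : z ∈ C) (h : HasGradientAt φ y x) :
    φ x + ⟪z - x, y⟫ ≤ φ z := by
  have h1 : HasDerivAt (fun t : ℝ => φ (x + t • (z - x))) ⟪y, z - x⟫ 0 :=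
    h.hasFDerivAt.hasLineDerivAt (z - x)
  have h2 := h1.tendsto_slope_zero_right
  have h3 : ⟪y, z - x⟫ ≤ φ z - φ x := by
    refine le_of_tendsto h2 ?_
    filter_upwards [Ioo_mem_nhdsGT (zero_lt_one' ℝ)] with t ht
    have h4 := hφ.2 hx hz (sub_nonneg.2 ht.2.le) ht.1.le (by ring)
    have h5 : (1 - t) • x + t • z = x + t • (z - x) := by module
    rw [h5] at h4
    simp only [zero_add, zero_smul, add_zero, smul_eq_mul] at h4 ⊢
    rw [inv_mul_le_iff₀ ht.1]
    linarith
  rw [real_inner_comm]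
  linarith

/-- Convex functions are locally Lipschitz on open sets, so Rademacher's theorem applies locally. -/
theorem ConvexOn.ae_differentiableAt {d : ℕ} {φ : E d → ℝ} {C : Set (E d)}
    (hφ : ConvexOn ℝ C φ) (hC : IsOpen C) : ∀ᵐ x, x ∈ C → DifferentiableAt ℝ φ x := by
  rw [ae_iff]
  refine measure_null_of_locally_null _ fun x hx => ?_
  simp only [Classical.not_imp, mem_ofPred_eq] at hx
  obtain ⟨K, t, ht, hKt⟩ := hφ.locallyLipschitzOn hC hx.1
  rw [hC.nhdsWithin_eq hx.1] at ht
  refine ⟨interior t ∩ {a | ¬(a ∈ C → DifferentiableAt ℝ φ a)},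
    inter_mem (mem_nhdsWithin_of_mem_nhds (interior_mem_nhds.2 ht)) self_mem_nhdsWithin, ?_⟩
  have h := (hKt.mono interior_subset).ae_differentiableWithinAt_of_mem (μ := volume)
  refine measure_mono_null (fun w hw => ?_) (ae_iff.1 h)
  refine mem_ofPred.2 fun hw' => hw.2 fun _ => ?_
  exact (hw' hw.1).differentiableAt (isOpen_interior.mem_nhds hw.1)

/-- The frontier of the convex domain and the nondifferentiability points inside it are
Lebesgue-null, so the first marginal avoids them; elsewhere the subgradient is the gradient. -/
theorem exists_convexGradient_of_cyclicallyMonotone {d : ℕ} {γ : Measure (E d × E d)}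
    [NeZero γ] (hac : γ.fst ≪ volume) {Γ : Set (E d × E d)} (hΓ : IsCyclicallyMonotone Γ)
    (hγ : ∀ᵐ z ∂γ, z ∈ Γ) :
    ∃ (C : Set (E d)) (φ : E d → ℝ), IsOpen C ∧ ConvexOn ℝ C φ ∧
      ∀ᵐ z ∂γ, z.1 ∈ C ∧ HasGradientAt φ z.2 z.1 := by
  obtain ⟨D, φ, hφ, hD⟩ := hΓ.exists_convex_potential hγ.exists
  have hfst : ∀ {p : E d → Prop}, (∀ᵐ x, p x) → ∀ᵐ z ∂γ, p z.1 := fun h =>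
    ae_of_ae_map measurable_fst.aemeasurable (hac.ae_le h)
  have hφ' : ConvexOn ℝ (interior D) φ := hφ.subset interior_subset hφ.1.interior
  refine ⟨interior D, φ, isOpen_interior, hφ', ?_⟩
  have h1 : ∀ᵐ x : E d, x ∉ frontier D :=
    measure_eq_zero_iff_ae_notMem.1 (hφ.1.addHaar_frontier volume)
  filter_upwards [hγ, hfst h1, hfst (ConvexOn.ae_differentiableAt hφ' isOpen_interior)]
    with z hz hz1 hz2
  have hzC : z.1 ∈ interior D := by
    by_contra h
    exact hz1 ⟨subset_closure (hD z hz).1, h⟩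
  exact ⟨hzC, hasGradientAt_of_subgradient (isOpen_interior.mem_nhds hzC) (hz2 hzC)
    fun w hw => (hD z hz).2 w (interior_subset hw)⟩

/-! ### The Monge problem with quadratic cost -/

/-- The quadratic cost. -/
noncomputable def sqCost {d : ℕ} (z : E d × E d) : ℝ := ‖z.1 - z.2‖ ^ 2

theorem continuous_sqCost {d : ℕ} : Continuous (sqCost (d := d)) := by
  unfold sqCost; fun_prop

theorem sqCost_nonneg {d : ℕ} (z : E d × E d) : 0 ≤ sqCost z := sq_nonneg _

/-- On expanding the squares, the squared norms cancel under a permutation. -/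
theorem IsOptimalCoupling.isCyclicallyMonotone_support {d : ℕ} {P Q : Measure (E d)}
    {γ : Measure (E d × E d)} [IsFiniteMeasure γ] (hγ : IsOptimalCoupling sqCost P Q γ)
    (hfin : ∫⁻ z, ENNReal.ofReal (sqCost z) ∂γ ≠ ∞) : IsCyclicallyMonotone γ.support := by
  intro n p σ hp
  have h := hγ.sum_le_sum_perm continuous_sqCost sqCost_nonneg hfin (fun i => (p i).1)
    (fun i => (p i).2) σ hp
  simp only [sqCost, norm_sub_sq_real, Finset.sum_add_distrib, Finset.sum_sub_distrib,
    ← Finset.mul_sum] at h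
  have := Equiv.sum_comp σ fun i => ‖(p i).2‖ ^ 2
  linarith

/-- An optimal coupling of finite cost whose first marginal is absolutely continuous is carried by
the graph of the gradient of a convex function. -/
theorem IsOptimalCoupling.exists_convexGradient {d : ℕ} {P Q : Measure (E d)}
    [IsProbabilityMeasure P] (hP : P ≪ volume)
    {γ : Measure (E d × E d)} (hγ : IsOptimalCoupling sqCost P Q γ)
    (hfin : ∫⁻ z, ENNReal.ofReal (sqCost z) ∂γ ≠ ∞) :
    ∃ g : E d → E d, Measurable g ∧ IsConvexGradient P g ∧ IsMonotoneAE P g ∧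
      ∀ᵐ z ∂γ, z.2 = g z.1 := by
  have : IsProbabilityMeasure γ := ⟨by rw [← Measure.fst_univ, hγ.1, measure_univ]⟩
  obtain ⟨C, φ, hC, hφ, h⟩ := exists_convexGradient_of_cyclicallyMonotone (by rwa [hγ.1])
    (hγ.isCyclicallyMonotone_support hfin) Measure.support_mem_ae
  have hg : Measurable (gradient φ) :=
    (InnerProductSpace.toDual ℝ (E d)).symm.continuous.measurable.comp (measurable_fderiv ℝ φ)
  have hSm : MeasurableSet (C ∩ {u | DifferentiableAt ℝ φ u}) :=
    hC.measurableSet.inter (measurableSet_of_differentiableAt ℝ φ)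
  have hS : ∀ᵐ u ∂P, u ∈ C ∩ {u | DifferentiableAt ℝ φ u} := by
    rw [← hγ.1]
    exact (ae_map_iff measurable_fst.aemeasurable hSm).2
      (h.mono fun z hz => ⟨hz.1, hz.2.differentiableAt⟩)
  refine ⟨gradient φ, hg, ⟨C, φ, hC, hφ, hS.mono fun u hu => hu.1,
    hS.mono fun u hu => hu.2.hasGradientAt⟩, ⟨_, hSm, hS, fun u hu v hv => ?_⟩,
    h.mono fun z hz => hz.2.gradient.symm⟩
  -- Adding the tangent inequalities at `u` and `v` gives monotonicity.
  have h1 := ConvexOn.add_inner_le_of_hasGradientAt hφ hu.1 hv.1 hu.2.hasGradientAt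
  have h2 := ConvexOn.add_inner_le_of_hasGradientAt hφ hv.1 hu.1 hv.2.hasGradientAt
  rw [real_inner_comm, inner_sub_right]
  rw [← neg_sub u v, inner_neg_left] at h1
  linarith

/-! ### Couplings of measures with finite second moments -/

section Moments

variable {d : ℕ} {P Q : Measure (E d)} {γ : Measure (E d × E d)}

theorem integrable_comp_fst {f : E d → ℝ} (h₁ : γ.fst = P) (hf : Integrable f P) :
    Integrable (fun z => f z.1) γ :=
  MeasurePreserving.integrable_comp_of_integrable ⟨measurable_fst, h₁⟩ hf

theorem integrable_comp_snd {f : E d → ℝ} (h₂ : γ.snd = Q) (hf : Integrable f Q) :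
    Integrable (fun z => f z.2) γ :=
  MeasurePreserving.integrable_comp_of_integrable ⟨measurable_snd, h₂⟩ hf

theorem integral_comp_fst {f : E d → ℝ} (h₁ : γ.fst = P) (hf : Integrable f P) :
    ∫ z, f z.1 ∂γ = ∫ u, f u ∂P := by
  subst h₁
  exact (integral_map measurable_fst.aemeasurable hf.1).symm

theorem integral_comp_snd {f : E d → ℝ} (h₂ : γ.snd = Q) (hf : Integrable f Q) :
    ∫ z, f z.2 ∂γ = ∫ u, f u ∂Q := by
  subst h₂
  exact (integral_map measurable_snd.aemeasurable hf.1).symm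

theorem integrable_inner_of_sq {α : Type*} [MeasurableSpace α] {μ : Measure α} {f g : α → E d}
    (hf : AEStronglyMeasurable f μ) (hg : AEStronglyMeasurable g μ)
    (hf2 : Integrable (fun a => ‖f a‖ ^ 2) μ) (hg2 : Integrable (fun a => ‖g a‖ ^ 2) μ) :
    Integrable (fun a => ⟪f a, g a⟫) μ := by
  refine (hf2.add hg2).mono' (hf.inner hg) (Eventually.of_forall fun a => ?_)
  have h1 := abs_real_inner_le_norm (f a) (g a)
  simp only [Real.norm_eq_abs, Pi.add_apply]
  nlinarith [sq_nonneg (‖f a‖ - ‖g a‖), sq_nonneg ‖f a‖, sq_nonneg ‖g a‖]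

theorem integrable_inner_coupling (h₁ : γ.fst = P) (h₂ : γ.snd = Q)
    (hm₁ : Integrable (fun u : E d => ‖u‖ ^ 2) P)
    (hm₂ : Integrable (fun u : E d => ‖u‖ ^ 2) Q) :
    Integrable (fun z : E d × E d => ⟪z.1, z.2⟫) γ :=
  integrable_inner_of_sq measurable_fst.aestronglyMeasurable measurable_snd.aestronglyMeasurable
    (integrable_comp_fst h₁ hm₁) (integrable_comp_snd h₂ hm₂)

theorem lintegral_sqCost_eq (h₁ : γ.fst = P) (h₂ : γ.snd = Q)
    (hm₁ : Integrable (fun u : E d => ‖u‖ ^ 2) P)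
    (hm₂ : Integrable (fun u : E d => ‖u‖ ^ 2) Q) :
    ∫⁻ z, ENNReal.ofReal (sqCost z) ∂γ =
    ENNReal.ofReal (∫ u, ‖u‖ ^ 2 ∂P + ∫ u, ‖u‖ ^ 2 ∂Q - 2 * ∫ z, ⟪z.1, z.2⟫ ∂γ) := by
  have hi := integrable_inner_coupling h₁ h₂ hm₁ hm₂
  have hx := integrable_comp_fst h₁ hm₁
  have hy := integrable_comp_snd h₂ hm₂
  have hxy : Integrable (fun z : E d × E d => ‖z.1‖ ^ 2 + ‖z.2‖ ^ 2) γ := hx.add hy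
  have heq : (fun z : E d × E d => sqCost z) =
      fun z => (‖z.1‖ ^ 2 + ‖z.2‖ ^ 2) - 2 * ⟪z.1, z.2⟫ := by
    funext z; rw [sqCost, norm_sub_sq_real]; ring
  rw [← ofReal_integral_eq_lintegral_ofReal _ (Eventually.of_forall sqCost_nonneg), heq,
    integral_sub hxy (hi.const_mul 2), integral_add hx hy, integral_const_mul,
    integral_comp_fst h₁ hm₁, integral_comp_snd h₂ hm₂]
  change Integrable (fun z => sqCost z) γ
  rw [heq]
  exact hxy.sub (hi.const_mul 2)

theorem lintegral_sqCost_ne_top (h₁ : γ.fst = P) (h₂ : γ.snd = Q)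
    (hm₁ : Integrable (fun u : E d => ‖u‖ ^ 2) P)
    (hm₂ : Integrable (fun u : E d => ‖u‖ ^ 2) Q) :
    ∫⁻ z, ENNReal.ofReal (sqCost z) ∂γ ≠ ∞ := by
  rw [lintegral_sqCost_eq h₁ h₂ hm₁ hm₂]
  exact ENNReal.ofReal_ne_top

end Moments

/-! ### Couplings carried by graphs, and Brenier's theorem -/

variable {d : ℕ} {P Q : Measure (E d)}

/-- The coupling carried by the graph of `g`. -/
noncomputable def graphCoupling (P : Measure (E d)) (g : E d → E d) : Measure (E d × E d) :=
  P.map fun u => (u, g u)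

theorem graphCoupling_fst {g : E d → E d} (hg : Measurable g) : (graphCoupling P g).fst = P := by
  rw [graphCoupling, Measure.fst_map_prodMk hg, Measure.map_id']

theorem graphCoupling_snd {g : E d → E d} (hg : MeasurePreserving g P Q) :
    (graphCoupling P g).snd = Q := by
  rw [graphCoupling, Measure.snd_map_prodMk measurable_id', hg.map_eq]

theorem lintegral_graphCoupling {g : E d → E d} (hg : Measurable g) :
    ∫⁻ z, ENNReal.ofReal (sqCost z) ∂(graphCoupling P g) = quadCost P g := by
  rw [graphCoupling, lintegral_map (by unfold sqCost; fun_prop) (by fun_prop)]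
  rfl

theorem ae_graphCoupling {g h : E d → E d} (hg : Measurable g)
    (hgh : ∀ᵐ z ∂(graphCoupling P g), z.2 = h z.1) : g =ᵐ[P] h :=
  ae_of_ae_map (by fun_prop) hgh

theorem eq_graphCoupling {γ : Measure (E d × E d)} {g : E d → E d} (hg : Measurable g)
    (h₁ : γ.fst = P) (h : ∀ᵐ z ∂γ, z.2 = g z.1) : γ = graphCoupling P g := by
  rw [graphCoupling, ← h₁, Measure.fst, Measure.map_map (by fun_prop) measurable_fst]
  conv_lhs => rw [← Measure.map_id (μ := γ)]
  exact Measure.map_congr (h.mono fun z hz => Prod.ext rfl hz)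

/-- A convex gradient is an optimal transport map. -/
theorem IsConvexGradient.isOptimalCoupling [IsProbabilityMeasure P]
    (hm₁ : Integrable (fun u : E d => ‖u‖ ^ 2) P) (hm₂ : Integrable (fun u : E d => ‖u‖ ^ 2) Q)
    {g : E d → E d} (hg : MeasurePreserving g P Q) (hgrad : IsConvexGradient P g) :
    IsOptimalCoupling sqCost P Q (graphCoupling P g) := by
  have : IsProbabilityMeasure Q := by
    rw [← hg.map_eq]; exact Measure.isProbabilityMeasure_map hg.measurable.aemeasurable
  obtain ⟨C, φ, hC, hφ, hPC, hPg⟩ := hgrad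
  obtain ⟨x₀, hx₀, hgx₀⟩ := (hPC.and hPg).exists
  have : Nonempty C := ⟨⟨x₀, hx₀⟩⟩
  have hcont : ContinuousOn φ C := hφ.continuousOn hC
  -- The Legendre conjugate is taken over a countable dense subset of `C` to keep it measurable;
  -- continuity of `φ` restores Young's inequality on all of `C`.
  let f : ℕ → E d → ℝ := fun n y =>
    ⟪(TopologicalSpace.denseSeq C n : E d), y⟫ - φ (TopologicalSpace.denseSeq C n)
  have hf : ∀ n, Measurable (f n) := fun n => by fun_prop
  let ψ : E d → ℝ := fun y => ⨆ n, f n y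
  have hψ : Measurable ψ := Measurable.iSup hf
  let B : Set (E d) := {y | BddAbove (range fun n => f n y)}
  have hB : MeasurableSet B := measurableSet_bddAbove_range hf
  have young : ∀ x ∈ C, ∀ y ∈ B, ⟪x, y⟫ ≤ φ x + ψ y := by
    intro x hx y hy
    have hcl : IsClosed {w : C | ⟪(w : E d), y⟫ ≤ φ w + ψ y} :=
      isClosed_le (by fun_prop) ((continuousOn_iff_continuous_domRestrict.1 hcont).add
        continuous_const)
    have hsub : closure (range (TopologicalSpace.denseSeq C)) ⊆
        {w : C | ⟪(w : E d), y⟫ ≤ φ w + ψ y} := by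
      refine closure_minimal ?_ hcl
      rintro _ ⟨n, rfl⟩
      have : f n y ≤ ψ y := le_ciSup hy n
      simp only [f] at this
      simp only [mem_ofPred_eq]
      linarith
    rw [(TopologicalSpace.denseRange_denseSeq C).closure_range] at hsub
    exact hsub (mem_univ (⟨x, hx⟩ : C))
  have conj : ∀ x ∈ C, ∀ y, HasGradientAt φ y x → y ∈ B ∧ φ x + ψ y = ⟪x, y⟫ := by
    intro x hx y hxy
    have h1 : ∀ n, f n y ≤ ⟪x, y⟫ - φ x := by
      intro n
      have := ConvexOn.add_inner_le_of_hasGradientAt hφ hx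
        (TopologicalSpace.denseSeq C n).2 hxy
      rw [inner_sub_left] at this
      simp only [f]
      linarith
    have hy : y ∈ B := ⟨_, by rintro _ ⟨n, rfl⟩; exact h1 n⟩
    refine ⟨hy, le_antisymm ?_ (young x hx y hy)⟩
    have : ψ y ≤ ⟪x, y⟫ - φ x := ciSup_le h1
    linarith
  have hPB : ∀ᵐ u ∂P, g u ∈ B := by
    filter_upwards [hPC, hPg] with u hu hu'
    exact (conj u hu _ hu').1
  have hQB : ∀ᵐ y ∂Q, y ∈ B := by
    rw [← hg.map_eq]
    exact (ae_map_iff hg.measurable.aemeasurable hB).2 hPB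
  have heq : ∀ᵐ u ∂P, φ u + ψ (g u) = ⟪u, g u⟫ := by
    filter_upwards [hPC, hPg] with u hu hu'
    exact (conj u hu _ hu').2
  have hm₁' : Integrable (fun u : E d => u) P :=
    ((memLp_two_iff_integrable_sq_norm (by fun_prop)).2 hm₁).integrable (by norm_num)
  have hm₂' : Integrable (fun u : E d => u) Q :=
    ((memLp_two_iff_integrable_sq_norm (by fun_prop)).2 hm₂).integrable (by norm_num)
  have hgint : Integrable g P := hg.integrable_comp_of_integrable hm₂'
  have hinner : Integrable (fun u => ⟪u, g u⟫) P :=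
    integrable_inner_of_sq (by fun_prop) hg.measurable.aestronglyMeasurable hm₁
      (hg.integrable_comp_of_integrable hm₂)
  have hφm : AEStronglyMeasurable φ P := by
    have := hcont.aestronglyMeasurable (μ := P) hC.measurableSet
    rwa [Measure.restrict_eq_self_of_ae_mem hPC] at this
  -- Below, `φ` is bounded by its tangent at `x₀`; above, by Young's inequality at `x₀` combined
  -- with the equality case at `u`.
  have hφint : Integrable φ P := by
    refine integrable_of_le_of_le (g₁ := fun u => φ x₀ + ⟪u - x₀, g x₀⟫)
      (g₂ := fun u => ⟪u, g u⟫ - ⟪x₀, g u⟫ + φ x₀) hφm ?_ ?_ ?_ ?_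
    · filter_upwards [hPC] with u hu
      exact ConvexOn.add_inner_le_of_hasGradientAt hφ hx₀ hu hgx₀
    · filter_upwards [heq, hPB] with u hu hu'
      have := young x₀ hx₀ _ hu'
      linarith
    · exact (integrable_const _).add ((hm₁'.sub (integrable_const _)).inner_const _)
    · exact (hinner.sub (hgint.const_inner _)).add (integrable_const _)
  have hψg : Integrable (fun u => ψ (g u)) P :=
    (hinner.sub hφint).congr (heq.mono fun u hu => by simp only [Pi.sub_apply]; linarith)
  have hψint : Integrable ψ Q :=
    (hg.integrable_comp hψ.aestronglyMeasurable).1 hψg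
  have hfst := graphCoupling_fst (P := P) hg.measurable
  have hsnd := graphCoupling_snd hg
  refine ⟨hfst, hsnd, fun γ h₁ h₂ => ?_⟩
  rw [lintegral_sqCost_eq hfst hsnd hm₁ hm₂, lintegral_sqCost_eq h₁ h₂ hm₁ hm₂]
  refine ENNReal.ofReal_le_ofReal ?_
  -- Duality: `∫ φ + ∫ ψ` bounds the correlation of every coupling and is attained by the graph of
  -- `g`.
  have h3 : ∫ z, ⟪z.1, z.2⟫ ∂(graphCoupling P g) = ∫ u, φ u ∂P + ∫ y, ψ y ∂Q := by
    rw [graphCoupling, integral_map (by fun_prop) (by fun_prop), ← hg.map_eq,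
      integral_map hg.measurable.aemeasurable hψ.aestronglyMeasurable,
      ← integral_add hφint hψg]
    exact integral_congr_ae (heq.mono fun u hu => hu.symm)
  have h4 : ∫ z, ⟪z.1, z.2⟫ ∂γ ≤ ∫ u, φ u ∂P + ∫ y, ψ y ∂Q := by
    have hφ1 := integrable_comp_fst h₁ hφint
    have hψ2 := integrable_comp_snd h₂ hψint
    rw [← integral_comp_fst h₁ hφint, ← integral_comp_snd h₂ hψint, ← integral_add hφ1 hψ2]
    refine integral_mono_ae (integrable_inner_coupling h₁ h₂ hm₁ hm₂) (hφ1.add hψ2) ?_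
    rw [← h₁] at hPC
    rw [← h₂] at hQB
    filter_upwards [ae_of_ae_map measurable_fst.aemeasurable hPC,
      ae_of_ae_map measurable_snd.aemeasurable hQB] with z hz1 hz2
    exact young _ hz1 _ hz2
  linarith

/-- Two optimal couplings carried by graphs agree. -/
theorem ae_eq_of_isOptimalCoupling_graphCoupling [IsProbabilityMeasure P] (hP : P ≪ volume)
    (hm₁ : Integrable (fun u : E d => ‖u‖ ^ 2) P) (hm₂ : Integrable (fun u : E d => ‖u‖ ^ 2) Q)
    {f g : E d → E d} (hfm : Measurable f) (hgm : Measurable g)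
    (hf : IsOptimalCoupling sqCost P Q (graphCoupling P f))
    (hg : IsOptimalCoupling sqCost P Q (graphCoupling P g)) : f =ᵐ[P] g := by
  set γ := (2⁻¹ : ℝ≥0∞) • graphCoupling P f + (2⁻¹ : ℝ≥0∞) • graphCoupling P g with hγ
  have h₁ : γ.fst = P := by
    rw [hγ, Measure.fst_add, Measure.fst, Measure.fst, Measure.map_smul, Measure.map_smul,
      ← Measure.fst, ← Measure.fst, hf.1, hg.1, ← add_smul, ENNReal.inv_two_add_inv_two, one_smul]
  have h₂ : γ.snd = Q := by
    rw [hγ, Measure.snd_add, Measure.snd, Measure.snd, Measure.map_smul, Measure.map_smul,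
      ← Measure.snd, ← Measure.snd, hf.2.1, hg.2.1, ← add_smul, ENNReal.inv_two_add_inv_two,
      one_smul]
  have hopt : IsOptimalCoupling sqCost P Q γ := by
    refine ⟨h₁, h₂, fun γ' h₁' h₂' => ?_⟩
    rw [hγ, lintegral_add_measure, lintegral_smul_measure, lintegral_smul_measure]
    calc _ ≤ (2⁻¹ : ℝ≥0∞) • ∫⁻ z, ENNReal.ofReal (sqCost z) ∂γ' +
          (2⁻¹ : ℝ≥0∞) • ∫⁻ z, ENNReal.ofReal (sqCost z) ∂γ' := by
          exact add_le_add (mul_le_mul' le_rfl (hf.2.2 γ' h₁' h₂'))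
            (mul_le_mul' le_rfl (hg.2.2 γ' h₁' h₂'))
      _ = _ := by rw [← add_smul, ENNReal.inv_two_add_inv_two, one_smul]
  -- The average is carried by a single graph, which both `f` and `g` must follow.
  obtain ⟨h, -, -, -, hh⟩ := hopt.exists_convexGradient hP
    (lintegral_sqCost_ne_top h₁ h₂ hm₁ hm₂)
  rw [hγ, ae_add_measure_iff, Measure.ae_ennreal_smul_measure_iff (by simp),
    Measure.ae_ennreal_smul_measure_iff (by simp)] at hh
  exact (ae_graphCoupling hfm hh.1).trans (ae_graphCoupling hgm hh.2).symm

theorem IsOptimalCoupling.swap {γ : Measure (E d × E d)} (hγ : IsOptimalCoupling sqCost P Q γ) :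
    IsOptimalCoupling sqCost Q P (γ.map Prod.swap) := by
  have hc : ∀ μ : Measure (E d × E d), ∫⁻ z, ENNReal.ofReal (sqCost z) ∂(μ.map Prod.swap) =
      ∫⁻ z, ENNReal.ofReal (sqCost z) ∂μ := by
    intro μ
    rw [lintegral_map (by unfold sqCost; fun_prop) measurable_swap]
    refine lintegral_congr fun z => ?_
    simp only [sqCost, Prod.fst_swap, Prod.snd_swap, norm_sub_rev]
  refine ⟨by rw [Measure.fst_map_swap, hγ.2.1], by rw [Measure.snd_map_swap, hγ.1],
    fun γ' h₁ h₂ => ?_⟩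
  rw [hc, ← hc γ']
  exact hγ.2.2 _ (by rw [Measure.fst_map_swap, h₂]) (by rw [Measure.snd_map_swap, h₁])

/-- Brenier's theorem. -/
theorem exists_optimalMap [IsProbabilityMeasure P] [IsProbabilityMeasure Q]
    (hP : P ≪ volume) (hQ : Q ≪ volume)
    (hm₁ : Integrable (fun u : E d => ‖u‖ ^ 2) P) (hm₂ : Integrable (fun u : E d => ‖u‖ ^ 2) Q) :
    ∃ g : E d → E d, IsOptimalMap P Q g ∧ quadCost P g < ∞ ∧ IsConvexGradient P g ∧
      IsMonotoneAE P g ∧ IsBijectiveAE P Q g ∧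
      (∀ g' : E d → E d, IsOptimalMap P Q g' → g' =ᵐ[P] g) ∧
      (∀ g' : E d → E d, MeasurePreserving g' P Q → IsConvexGradient P g' → g' =ᵐ[P] g) := by
  obtain ⟨γ, hγ⟩ := exists_isOptimalCoupling continuous_sqCost P Q
  have hfin := lintegral_sqCost_ne_top hγ.1 hγ.2.1 hm₁ hm₂
  obtain ⟨g, hgm, hgrad, hmono, hgγ⟩ := hγ.exists_convexGradient hP hfin
  -- The same coupling read backwards lies on a graph over `Q`, so `h` is an a.e. left inverse of
  -- `g`.
  obtain ⟨h, hhm, -, -, hhγ⟩ := hγ.swap.exists_convexGradient hQ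
    (lintegral_sqCost_ne_top hγ.swap.1 hγ.swap.2.1 hm₂ hm₁)
  have hγg := eq_graphCoupling hgm hγ.1 hgγ
  rw [hγg] at hγ hfin hhγ
  rw [lintegral_graphCoupling hgm] at hfin
  have hg : MeasurePreserving g P Q := ⟨hgm, by
    rw [← hγ.2.1, graphCoupling, Measure.snd_map_prodMk measurable_id']⟩
  have hmin : ∀ T : E d → E d, MeasurePreserving T P Q → quadCost P g ≤ quadCost P T := by
    intro T hT
    rw [← lintegral_graphCoupling hgm, ← lintegral_graphCoupling hT.measurable]
    exact hγ.2.2 _ (graphCoupling_fst hT.measurable) (graphCoupling_snd hT)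
  have hinf : quadCost P g = ⨅ (T : E d → E d) (_ : MeasurePreserving T P Q), quadCost P T :=
    le_antisymm (le_iInf₂ hmin) (iInf₂_le g hg)
  refine ⟨g, ⟨hg, hinf⟩, hfin.lt_top, hgrad, hmono, ?_, fun g' hg' => ?_, fun g' hg' hgrad' => ?_⟩
  · have hhg : ∀ᵐ u ∂P, u = h (g u) :=
      ae_of_ae_map (by fun_prop) (ae_of_ae_map measurable_swap.aemeasurable hhγ)
    refine IsBijectiveAE.of_injOn (S := {u | u = h (g u)}) hg
      (measurableSet_eq_fun measurable_id (hhm.comp hgm)) hhg fun u hu v hv huv => ?_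
    rw [mem_ofPred_eq] at hu hv
    rw [hu, hv, huv]
  -- The best map and the best coupling have equal cost, so any optimal map induces an optimal
  -- coupling.
  · refine ae_eq_of_isOptimalCoupling_graphCoupling hP hm₁ hm₂ hg'.1.measurable hgm
      ⟨graphCoupling_fst hg'.1.measurable, graphCoupling_snd hg'.1, fun γ' h₁ h₂ => ?_⟩ hγ
    rw [lintegral_graphCoupling hg'.1.measurable, hg'.2, ← hinf, ← lintegral_graphCoupling hgm]
    exact hγ.2.2 γ' h₁ h₂
  · exact ae_eq_of_isOptimalCoupling_graphCoupling hP hm₁ hm₂ hg'.measurable hgm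
      (hgrad'.isOptimalCoupling hm₁ hm₂ hg') hγ

end PriorTransport

theorem mainTheorem4 (d : ℕ) (P₁ P₂ : Measure (PriorTransport.E d))
    [IsProbabilityMeasure P₁] [IsProbabilityMeasure P₂]
    (hac₁ : P₁ ≪ volume) (hac₂ : P₂ ≪ volume)
    (hm₁ : Integrable (fun u : PriorTransport.E d => ‖u‖ ^ 2) P₁)
    (hm₂ : Integrable (fun u : PriorTransport.E d => ‖u‖ ^ 2) P₂) :
    (∃ g : PriorTransport.E d → PriorTransport.E d,
      PriorTransport.IsOptimalMap P₁ P₂ g ∧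
      PriorTransport.quadCost P₁ g < ⊤ ∧
      PriorTransport.IsConvexGradient P₁ g ∧
      PriorTransport.IsMonotoneAE P₁ g ∧
      PriorTransport.IsBijectiveAE P₁ P₂ g ∧
      (∀ g' : PriorTransport.E d → PriorTransport.E d,
        PriorTransport.IsOptimalMap P₁ P₂ g' → g' =ᵐ[P₁] g) ∧
      (∀ g' : PriorTransport.E d → PriorTransport.E d,
        MeasurePreserving g' P₁ P₂ → PriorTransport.IsConvexGradient P₁ g' → g' =ᵐ[P₁] g)) ∧
    (∀ (P : Measure (PriorTransport.E d)) [IsProbabilityMeasure P], P ≪ volume →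
      MeasurePreserving (PriorTransport.rosenblatt P) (PriorTransport.unifCube d) P ∧
      PriorTransport.IsTriangular (PriorTransport.rosenblatt P) ∧
      PriorTransport.IsBijectiveAE (PriorTransport.unifCube d) P (PriorTransport.rosenblatt P) ∧
      ∀ (k : ℕ) (T : PriorTransport.E d → PriorTransport.E k → PriorTransport.E d),
        (∀ pa, Measurable fun u => T u pa) →
        PriorTransport.TransportEquiv T P
          (fun u pa => T (PriorTransport.rosenblatt P u) pa) (PriorTransport.unifCube d) ∧
        ∀ pa, (PriorTransport.unifCube d).map
            (fun u => T (PriorTransport.rosenblatt P u) pa) = P.map (fun u => T u pa)) := by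
  refine ⟨PriorTransport.exists_optimalMap hac₁ hac₂ hm₁ hm₂, fun P _ hP => ?_⟩
  have hR := PriorTransport.measurePreserving_rosenblatt P
  refine ⟨hR, PriorTransport.isTriangular_rosenblatt P,
    PriorTransport.isBijectiveAE_rosenblatt P hP, fun k T hT =>
    ⟨PriorTransport.transportEquiv_rosenblatt P hP T, fun pa => ?_⟩⟩
  conv_rhs => rw [← hR.map_eq]
  exact (Measure.map_map (hT pa) hR.measurable).symm
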